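/- Consider the system $\dot q=(\dot x,\dot y,\dot z)=(F_1(q),F_2(q),F_3(q))$ (real time), $q\in\mathbb{C}^3$, where $F=(F_1,F_2,F_3)$ is holomorphic near the origin and $F(0)=0$. Assume that the linear part $\Lambda=DF(0)$ has eigenvalues $i\omega_1,i\omega_2,\lambda$, where $\omega_1\ne\omega_2$ are nonzero real numbers, $|\omega_1|\le|\omega_2|$, $\operatorname{Re}\lambda\ne0$, and that the $x$-axis and the $y$-axis are the eigenspaces of $i\omega_1$ and $i\omega_2$; let $w$ be an eigenvector for $\lambda$. A *holomorphic center manifold* (at the origin) is here a one-dimensional complex submanifold $M$ of a neighbourhood of the origin, with $0\in M$, that is locally invariant under the flow near the origin and tangent at the origin to a line in the center subspace of $\Lambda$; it is *$x$-invariant* (*$y$-invariant*) if it is tangent to the $x$-axis ($y$-axis). Center manifolds are identified if they coincide near the origin. $M$ contains an *isochronous center family of period $T$* if all points of $M\setminus\{0\}$ near the origin lie on closed orbits in $M$ of minimal period $T$, which lie in any prescribed neighbourhood of the origin if they start close enough to it. When $\mu=\omega_2/\omega_1\in\mathbb{N}$ (so that $\mu\ge2$), define $\bar p\in\mathbb{C}$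 as follows. In the linear coordinates of the basis $(1,0,0),(0,1,0),w$, still denoted $x,y,z$, the substitution $y=xu(x)$, $z=xv(x)$ turns the equations $F_1y'=F_2$, $F_1z'=F_3$ of invariant curves $(x,y(x),z(x))$ into the Briot–Bouquet system $xu'=F_2/F_1-u$, $xv'=F_3/F_1-v$ (evaluated at $(x,xu,xv)$), which has the form $xu'=px+qu+O(2)$, $xv'=rx+sv+O(2)$ with $q=\mu-1$ and $s=\lambda/(i\omega_1)-1$. Apply $\mu-2$ times the change of unknowns $u=x\bigl(\tilde u+\tfrac{p}{1-q}\bigr)$, $v=x\bigl(\tilde v+\tfrac{r}{1-s}\bigr)$, where $p,q,r,s$ are the coefficients of the system at the current step; each step gives a system of the same form with $q,s$ replaced by $q-1,s-1$. Then $\bar p$ is the coefficient of $x$ in the first equation, $x\bar u'=\bar p x+\bar u+O(2)$, of the final system. Then: 1) The system has a $y$-invariant holomorphic center manifold that contains an isochronous center family of period $2\pi/|\omega_2|$. 2) If $\omega_2/\omega_1\notin\mathbb{N}$, it has an $x$-invariant holomorphic center manifold that contains an isochronous center family of period $2\pi/|\omega_1|$. 3) Let $\omega_2/\omega_1\in\mathbb{N}$.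 3.1) If $\bar p=0$, the system has infinitely many $x$-invariant holomorphic center manifolds, and each of its $x$-invariant holomorphic center manifolds contains an isochronous center family of period $2\pi/|\omega_1|$. 3.2) If $\bar p\neq0$, the system has no holomorphic center manifold other than the $y$-invariant one of 1), which is then unique; in particular it has no $x$-invariant one. -/

import Mathlib

open Filter Topology

/-- The complex phase space `ℂ³` with coordinates `(x, y, z)`. -/
abbrev Phase : Type := ℂ × ℂ × ℂ

/-- The center subspace of a linear operator: the sum of the generalized eigenspaces of all
eigenvalues with real part zero. -/
def centerSubspace (A : Phase →L[ℂ] Phase) : Submodule ℂ Phase :=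
  ⨆ (κ : ℂ) (_ : κ.re = 0), Module.End.maxGenEigenspace (A : Module.End ℂ Phase) κ

/-- `M` is a one-dimensional complex submanifold of an open neighbourhood `N` of the origin
(the regular zero set of a holomorphic map `N → ℂ²`) that contains the origin and whose tangent
space at the origin is the complex line spanned by `v`. -/
def IsHolomorphicCurve (v : Phase) (M : Set Phase) : Prop :=
  ∃ (N : Set Phase) (h : Phase → ℂ × ℂ),
    IsOpen N ∧ (0 : Phase) ∈ N ∧ DifferentiableOn ℂ h N ∧
    M = {q ∈ N | h q = 0} ∧ (0 : Phase) ∈ M ∧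
    (∀ q ∈ M, Function.Surjective (fderiv ℂ h q)) ∧
    ∀ a : Phase, fderiv ℂ h 0 a = 0 ↔ a ∈ Submodule.span ℂ {v}

/-- `M` is locally invariant at the origin under the flow of the system `dq/dt = F q` (real
time): a solution arc that stays in a suitable neighbourhood of the origin and meets `M` lies
in `M`. -/
def LocallyInvariant (F : Phase → Phase) (M : Set Phase) : Prop :=
  ∃ N ∈ 𝓝 (0 : Phase), ∀ (φ : ℝ → Phase) (a b : ℝ),
    (∀ t ∈ Set.Icc a b, φ t ∈ N ∧ HasDerivWithinAt φ (F (φ t)) (Set.Icc a b) t) →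
    (∃ t ∈ Set.Icc a b, φ t ∈ M) → ∀ t ∈ Set.Icc a b, φ t ∈ M

/-- `M` is a (one-dimensional) holomorphic center manifold at the origin of `dq/dt = F q`,
tangent to the line spanned by `v`, which has to lie in the center subspace. -/
structure IsCenterManifold (F : Phase → Phase) (v : Phase) (M : Set Phase) : Prop where
  ne_zero : v ≠ 0
  mem_center : v ∈ centerSubspace (fderiv ℂ F 0)
  curve : IsHolomorphicCurve v M
  invariant : LocallyInvariant F M

/-- `M` contains an isochronous center family of period `T`: all points of `M \ {0}` close to
the origin lie on closed orbits in `M`, as close to the origin as we please, each of them with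
the minimal period `T`. -/
def HasIsochronousCenterFamily (F : Phase → Phase) (M : Set Phase) (T : ℝ) : Prop :=
  ∀ V ∈ 𝓝 (0 : Phase), ∃ W ∈ 𝓝 (0 : Phase), ∀ p ∈ M ∩ W, p ≠ 0 →
    ∃ φ : ℝ → Phase, φ 0 = p ∧ (∀ t, HasDerivAt φ (F (φ t)) t) ∧ (∀ t, φ t ∈ M ∩ V) ∧
      Function.Periodic φ T ∧ ∀ s ∈ Set.Ioo 0 T, φ s ≠ p

/-- The direction of the `x`-axis. -/
def xAxis : Phase := (1, 0, 0)

/-- The direction of the `y`-axis. -/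
def yAxis : Phase := (0, 1, 0)

/-- The vector field `F` written in the linear coordinates of the basis `xAxis, yAxis, w`
(where the third component of `w` is nonzero): the field `L⁻¹ ∘ F ∘ L` with
`L (x, y, z) = x • xAxis + y • yAxis + z • w`. -/
noncomputable def inBasis (w : Phase) (F : Phase → Phase) : Phase → Phase := fun p =>
  let q := F (p.1 • xAxis + p.2.1 • yAxis + p.2.2 • w)
  (q.1 - q.2.2 / w.2.2 * w.1, q.2.1 - q.2.2 / w.2.2 * w.2.1, q.2.2 / w.2.2)

/-- The right-hand side `B` of a two-dimensional system `x u' = (B x u v).1`,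
`x v' = (B x u v).2`. -/
abbrev BBSystem : Type := ℂ → ℂ → ℂ → ℂ × ℂ

/-- The Briot-Bouquet system satisfied by `(u, v)` when `(x, y(x), z(x))` with `y = x u`,
`z = x v` is an invariant curve of the field `F = (F₁, F₂, F₃)`, that is, when
`F₁ y' = F₂`, `F₁ z' = F₃`:  `x u' = F₂ / F₁ - u`, `x v' = F₃ / F₁ - v` at `(x, x u, x v)`.
Numerator and denominator are divided by `x`, with the derivative as the value at `x = 0`. -/
noncomputable def briotBouquet (F : Phase → Phase) : BBSystem := fun x u v =>
  let q := dslope (fun t : ℂ => F (t, t * u, t * v)) 0 x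
  (q.2.1 / q.1 - u, q.2.2 / q.1 - v)

/-- The coefficient `p` of `x` in the first component of a system
`x u' = p x + q u + ⋯`, `x v' = r x + s v + ⋯`. -/
noncomputable def coeffP (B : BBSystem) : ℂ := deriv (fun x => (B x 0 0).1) 0

/-- The coefficient `q` of `u` in the first component. -/
noncomputable def coeffQ (B : BBSystem) : ℂ := deriv (fun u => (B 0 u 0).1) 0

/-- The coefficient `r` of `x` in the second component. -/
noncomputable def coeffR (B : BBSystem) : ℂ := deriv (fun x => (B x 0 0).2) 0

/-- The coefficient `s` of `v` in the second component. -/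
noncomputable def coeffS (B : BBSystem) : ℂ := deriv (fun v => (B 0 0 v).2) 0

/-- One step of the reduction: the system for the new unknowns `(u₁, v₁)` given by
`u = x (u₁ + p / (1 - q))`, `v = x (v₁ + r / (1 - s))`. -/
noncomputable def bbStep (B : BBSystem) : BBSystem := fun x u v =>
  let c := coeffP B / (1 - coeffQ B)
  let d := coeffR B / (1 - coeffS B)
  dslope (fun t : ℂ => B t (t * (u + c)) (t * (v + d))) 0 x - (u + c, v + d)

/-- The resonance coefficient for the frequency ratio `n`: write the field in the basis
`xAxis, yAxis, w`, pass to the Briot-Bouquet system of the curves `(x, x u, x v)`, make `n - 2`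
steps of the reduction, and take the coefficient of `x` in the first equation. -/
noncomputable def pBar (F : Phase → Phase) (w : Phase) (n : ℕ) : ℂ :=
  coeffP (bbStep^[n - 2] (briotBouquet (inBasis w F)))

/-! In the basis `xAxis`, `yAxis`, `w` the linear part is diagonal. A curve tangent to the first
axis is a graph `(x, R x)` with `R 0 = 0` and `R' 0 = 0`, and it is invariant exactly when `R x / x`
is a holomorphic solution, vanishing at `0`, of the Briot-Bouquet system, whose linear part is
diagonal with entries `ω₂/ω₁ - 1` and `lam/(iω₁) - 1`. So everything reduces to counting such
solutions (`InvCurve.of_isBBSol`, `InvCurve.isBBSol`).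

The Briot-Bouquet theorem gives a solution (`BBForm.exists_sol`), and a unique one
(`IsBBSol.eventuallyEq`), when no positive integer is an eigenvalue. The entry with `lam` is never
real, so only the frequency ratio matters. With the axes exchanged it is `ω₁/ω₂ - 1`, never a
positive integer because `|ω₁| ≤ |ω₂|`: there is exactly one `y`-invariant germ. For the `x`-axis
the only obstruction is `ω₂/ω₁ = n` with `n ≥ 2`. Then `n - 2` substitutions `U = x (Ũ + e)` lower
the first eigenvalue to `1`, where the coefficient equation for the slope `e` has first component
`pBar + e - e = 0`. It is unsolvable if `pBar ≠ 0`; if `pBar = 0` the slope is free, and each choice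
yields a solution because the next substitution leaves no positive integer eigenvalue.

For existence in the nonresonant case, substitutions shift the linear part `A` to `A - N` with `N >
‖A‖`. The equation becomes `x U' + N U = g (x, U)`, where `g` has Lipschitz constant below `N` in
`U`; the operator `x d/dx + N` has an inverse of norm at most `1/N` (`radialAverage`), so a
contraction argument applies (`exists_sol_of_norm_lt`).

On an invariant curve the field is a one-variable holomorphic field with a simple zero of derivative
`iω`. It is holomorphically conjugate to `iω ζ` (`exists_linearization`), so its flow is a rotation
with minimal period `2π/|ω|` (`InvCurve.isochronous`). Finally, the tangent of any invariant curve
is an eigenvector; one lying in the center subspace spans the `x`-axis or the `y`-axis, since `ω₁ ≠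
ω₂` and `Re lam ≠ 0`. -/

/-! ### Holomorphic maps between normed spaces. -/

section Regularity

variable {E F : Type*} [NormedAddCommGroup E] [NormedSpace ℂ E]
  [NormedAddCommGroup F] [NormedSpace ℂ F]

/-- `f` is holomorphic near `p`: complex differentiable at all points close to `p`. -/
def HolAt (f : E → F) (p : E) : Prop := ∀ᶠ q in 𝓝 p, DifferentiableAt ℂ f q

theorem HolAt.differentiableAt {f : E → F} {p : E} (h : HolAt f p) : DifferentiableAt ℂ f p :=
  h.self_of_nhds

theorem HolAt.eventually {f : E → F} {p : E} (h : HolAt f p) : ∀ᶠ q in 𝓝 p, HolAt f q :=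
  eventually_eventually_nhds.2 h

theorem AnalyticAt.holAt [CompleteSpace F] {f : E → F} {p : E} (h : AnalyticAt ℂ f p) :
    HolAt f p :=
  h.eventually_analyticAt.mono fun _ hq => hq.differentiableAt

theorem HolAt.comp {G : Type*} [NormedAddCommGroup G] [NormedSpace ℂ G] {g : F → G} {f : E → F}
    {p : E} (hg : HolAt g (f p)) (hf : HolAt f p) : HolAt (fun x => g (f x)) p := by
  filter_upwards [hf, hf.differentiableAt.continuousAt.eventually hg] with q h1 h2
  exact DifferentiableAt.comp q h2 h1

theorem HolAt.congr {f g : E → F} {p : E} (hf : HolAt f p) (h : g =ᶠ[𝓝 p] f) : HolAt g p := by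
  filter_upwards [hf, h.eventually_nhds] with q h1 h2
  exact h1.congr_of_eventuallyEq h2

theorem Differentiable.holAt {f : E → F} (h : Differentiable ℂ f) (p : E) : HolAt f p :=
  Eventually.of_forall fun q => h q

/-- Cauchy's estimate for the Fréchet derivative. -/
theorem norm_fderiv_le_div_of_ball {f : E → F} {p : E} {R C : ℝ} (hR : 0 < R)
    (hf : DifferentiableOn ℂ f (Metric.ball p R)) (hb : ∀ q ∈ Metric.ball p R, ‖f q‖ ≤ C) :
    ‖fderiv ℂ f p‖ ≤ 2 * C / R := by
  refine Complex.norm_fderiv_le_div_of_mapsTo_ball ?_ ?_ hR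
  · exact hf
  · intro q hq
    rw [Metric.mem_closedBall, dist_eq_norm]
    have := hb q hq
    have := hb p (Metric.mem_ball_self hR)
    exact (norm_sub_le _ _).trans (by linarith)

/-- Cauchy's estimate is used twice: a bound on `f` makes `f` Lipschitz, and the estimate applied to
the difference of `f` and a translate makes `fderiv ℂ f` Lipschitz, hence continuous. This opens the
way to strict derivatives and the inverse function theorem. -/
theorem HolAt.contDiffAt {f : E → F} {p : E} (hf : HolAt f p) : ContDiffAt ℂ 1 f p := by
  obtain ⟨R, hR, hd⟩ : ∃ R > 0, ∀ q ∈ Metric.ball p R, DifferentiableAt ℂ f q ∧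
      ‖f q‖ ≤ ‖f p‖ + 1 := by
    have h2 : ∀ᶠ q in 𝓝 p, ‖f q‖ ≤ ‖f p‖ + 1 :=
      (hf.differentiableAt.continuousAt.norm.eventually_lt_const (lt_add_one _)).mono
        fun _ => le_of_lt
    obtain ⟨R, hR, h⟩ := Metric.eventually_nhds_iff_ball.1 (hf.and h2)
    exact ⟨R, hR, h⟩
  set C := ‖f p‖ + 1 with hC
  have hC0 : 0 ≤ C := by positivity
  have sub : ∀ q ∈ Metric.ball p (R / 2), Metric.ball q (R / 2) ⊆ Metric.ball p R := by
    intro q hq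
    apply Metric.ball_subset_ball'
    rw [Metric.mem_ball] at hq
    linarith
  have b1 : ∀ q ∈ Metric.ball p (R / 2), ‖fderiv ℂ f q‖ ≤ 2 * C / (R / 2) := fun q hq =>
    norm_fderiv_le_div_of_ball (by positivity)
      (fun z hz => (hd z (sub q hq hz)).1.differentiableWithinAt) fun z hz => (hd z (sub q hq hz)).2
  set K := 2 * C / (R / 2) with hK
  have hK0 : 0 ≤ K := by positivity
  have hsub2 : Metric.ball p (R / 2) ⊆ Metric.ball p R := Metric.ball_subset_ball (by linarith)
  let _ : NormedSpace ℝ E := NormedSpace.restrictScalars ℝ ℂ E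
  have lip : ∀ x ∈ Metric.ball p (R / 2), ∀ y ∈ Metric.ball p (R / 2), ‖f y - f x‖ ≤ K * ‖y - x‖ :=
    fun x hx y hy => (convex_ball p (R / 2)).norm_image_sub_le_of_norm_fderiv_le
      (fun z hz => (hd z (hsub2 hz)).1) b1 hx hy
  have b2 : ∀ x ∈ Metric.ball p (R / 8), ∀ y ∈ Metric.ball p (R / 8),
      ‖fderiv ℂ f y - fderiv ℂ f x‖ ≤ 2 * (K * ‖y - x‖) / (R / 4) := by
    intro x hx y hy
    rw [Metric.mem_ball] at hx hy
    have hyx : dist y x < R / 4 := by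
      have := dist_triangle_right y x p
      linarith
    have m1 : ∀ z ∈ Metric.ball x (R / 4), z ∈ Metric.ball p (R / 2) := by
      intro z hz
      rw [Metric.mem_ball] at hz ⊢
      have := dist_triangle z x p
      linarith
    have m2 : ∀ z ∈ Metric.ball x (R / 4), z + (y - x) ∈ Metric.ball p (R / 2) := by
      intro z hz
      rw [Metric.mem_ball] at hz ⊢
      have h3 : dist (z + (y - x)) y = dist z x := by
        rw [dist_eq_norm, dist_eq_norm]; congr 1; abel
      have := dist_triangle (z + (y - x)) y p
      linarith
    have hdiff : ∀ z ∈ Metric.ball x (R / 4),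
        HasFDerivAt (fun z => f (z + (y - x)) - f z)
          (fderiv ℂ f (z + (y - x)) - fderiv ℂ f z) z := fun z hz =>
      ((hasFDerivAt_comp_add_right (y - x)).2 (hd _ (hsub2 (m2 z hz))).1.hasFDerivAt).sub
        (hd _ (hsub2 (m1 z hz))).1.hasFDerivAt
    have hx0 := hdiff x (Metric.mem_ball_self (by positivity))
    have := norm_fderiv_le_div_of_ball (f := fun z => f (z + (y - x)) - f z) (p := x)
      (R := R / 4) (C := K * ‖y - x‖) (by positivity)
      (fun z hz => (hdiff z hz).differentiableAt.differentiableWithinAt)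
      (fun z hz => by simpa using lip _ (m1 z hz) _ (m2 z hz))
    rw [hx0.fderiv] at this
    simpa using this
  rw [contDiffAt_one_iff]
  refine ⟨fderiv ℂ f, Metric.ball p (R / 8), Metric.ball_mem_nhds _ (by positivity), ?_,
    fun x hx => (hd x (Metric.ball_subset_ball (by linarith) hx)).1.hasFDerivAt⟩
  have : LipschitzOnWith (2 * K / (R / 4)).toNNReal (fderiv ℂ f) (Metric.ball p (R / 8)) := by
    refine LipschitzOnWith.of_dist_le_mul fun x hx y hy => ?_
    rw [dist_eq_norm, dist_eq_norm, Real.coe_toNNReal _ (by positivity)]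
    exact (b2 y hy x hx).trans (le_of_eq (by ring))
  exact this.continuousOn

theorem HolAt.hasStrictFDerivAt {f : E → F} {p : E} (hf : HolAt f p) :
    HasStrictFDerivAt f (fderiv ℂ f p) p :=
  hf.contDiffAt.hasStrictFDerivAt one_ne_zero

theorem HolAt.continuousAt_fderiv {f : E → F} {p : E} (hf : HolAt f p) :
    ContinuousAt (fderiv ℂ f) p :=
  (hf.contDiffAt.fderiv_right (m := 0) (by norm_num)).continuousAt

theorem HolAt.analyticAt [CompleteSpace F] {f : ℂ → F} {p : ℂ} (hf : HolAt f p) :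
    AnalyticAt ℂ f p :=
  Complex.analyticAt_iff_eventually_differentiableAt.2 hf

/-- Integrals depending holomorphically on a parameter. -/
theorem HolAt.parametric_integral [CompleteSpace F] {Φ : ℂ × E → F} {γ : ℝ → ℂ}
    (hγ : Continuous γ) {a b : ℝ} (hab : a ≤ b) {p : E}
    (hΦ : ∀ t ∈ Set.Icc a b, HolAt Φ (γ t, p)) :
    HolAt (fun q => ∫ t in a..b, Φ (γ t, q)) p := by
  -- Compactness of the interval gives one derivative bound for all `t` and all nearby parameters,
  -- as domination under the integral sign requires.
  obtain ⟨C, hC⟩ : ∃ C : ℝ, ∀ᶠ q in 𝓝 p, ∀ t ∈ Set.Icc a b, HolAt Φ (γ t, q) ∧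
      ‖fderiv ℂ Φ (γ t, q)‖ ≤ C := by
    have hco : ContinuousOn (fun t => ‖fderiv ℂ Φ (γ t, p)‖) (Set.Icc a b) := fun t ht =>
      ((hΦ t ht).continuousAt_fderiv.norm.comp (f := fun t => (γ t, p)) (x := t)
        (by fun_prop)).continuousWithinAt
    obtain ⟨C, hC⟩ := (isCompact_Icc.image_of_continuousOn hco).bddAbove
    refine ⟨C + 1, isCompact_Icc.eventually_forall_of_forall_eventually
      (P := fun q t => HolAt Φ (γ t, q) ∧ ‖fderiv ℂ Φ (γ t, q)‖ ≤ C + 1) fun t ht => ?_⟩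
    have hcont : ContinuousAt (fun z : E × ℝ => (γ z.2, z.1)) (p, t) := by fun_prop
    have h1 : ‖fderiv ℂ Φ (γ t, p)‖ < C + 1 :=
      (hC (Set.mem_image_of_mem _ ht)).trans_lt (lt_add_one C)
    have h2 := (hΦ t ht).continuousAt_fderiv.norm.eventually_lt_const h1
    exact hcont.eventually ((hΦ t ht).eventually.and (h2.mono fun _ => le_of_lt))
  have hae : ∀ q, (∀ t ∈ Set.Icc a b, HolAt Φ (γ t, q)) →
      ContinuousOn (fun t => Φ (γ t, q)) (Set.uIcc a b) := by
    intro q hq t ht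
    rw [Set.uIcc_of_le hab] at ht
    exact ((hq t ht).differentiableAt.continuousAt.comp (f := fun t => (γ t, q)) (x := t)
        (by fun_prop)).continuousWithinAt
  have hio : Set.uIoc a b ⊆ Set.uIcc a b := Set.uIoc_subset_uIcc
  filter_upwards [hC.eventually_nhds] with q hq
  have hq0 := hq.self_of_nhds
  refine (intervalIntegral.hasFDerivAt_integral_of_dominated_of_fderiv_le (𝕜 := ℂ)
    (F := fun q t => Φ (γ t, q))
    (F' := fun q t => (fderiv ℂ Φ (γ t, q)).comp (ContinuousLinearMap.inr ℂ ℂ E))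
    (bound := fun _ => C * ‖ContinuousLinearMap.inr ℂ ℂ E‖) hq ?_ ?_ ?_ ?_ ?_ ?_).differentiableAt
  · filter_upwards [hq] with r hr
    exact ((hae r fun t ht => (hr t ht).1).mono hio).aestronglyMeasurable measurableSet_uIoc
  · exact (hae q fun t ht => (hq0 t ht).1).intervalIntegrable
  · refine ContinuousOn.aestronglyMeasurable (fun t ht => ?_) measurableSet_uIoc
    have ht' := hio ht
    rw [Set.uIcc_of_le hab] at ht'
    have h3 : ContinuousAt (fun t => fderiv ℂ Φ (γ t, q)) t :=
      (hq0 t ht').1.continuousAt_fderiv.comp (f := fun t => (γ t, q)) (x := t) (by fun_prop)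
    exact (h3.clm_comp continuousAt_const).continuousWithinAt
  · refine Eventually.of_forall fun t ht r hr => ?_
    have ht' := hio ht
    rw [Set.uIcc_of_le hab] at ht'
    exact (ContinuousLinearMap.opNorm_comp_le _ _).trans
      (mul_le_mul_of_nonneg_right (hr t ht').2 (norm_nonneg _))
  · exact intervalIntegrable_const
  · refine Eventually.of_forall fun t ht r hr => ?_
    have ht' := hio ht
    rw [Set.uIcc_of_le hab] at ht'
    exact (hr t ht').1.differentiableAt.hasFDerivAt.comp r (hasFDerivAt_prodMk_right (γ t) r)

/-- Division by the first variable keeps holomorphy. -/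
theorem HolAt.dslope [CompleteSpace F] {G : ℂ × E → F} {e : E} (hG : HolAt G (0, e)) :
    HolAt (fun p : ℂ × E => dslope (fun t => G (t, p.2)) 0 p.1) (0, e) := by
  obtain ⟨R, hR, hd⟩ := Metric.eventually_nhds_iff_ball.1 hG
  have hd' : ∀ z ∈ Metric.ball (0 : ℂ) R, ∀ q ∈ Metric.ball e R, HolAt G (z, q) := by
    intro z hz q hq
    refine Filter.mem_of_superset (Metric.isOpen_ball.mem_nhds (?_ : (z, q) ∈ Metric.ball (0, e) R))
      hd
    rw [← ball_prod_same]
    exact ⟨hz, hq⟩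
  have hr : R / 2 < R := by linarith
  have hr0 : 0 < R / 2 := by linarith
  -- This is Cauchy's formula for the slope on the circle of radius `R / 2`. The factor `z` from `dz
  -- = i z dt` cancels the denominator of the slope `(G z - G 0) / z`.
  have key : HolAt (fun p : ℂ × E => ∫ t in (0 : ℝ)..(2 * Real.pi),
      (fun w : ℂ × ℂ × E => (w.1 - w.2.1)⁻¹ • (G (w.1, w.2.2) - G (0, w.2.2)))
        (circleMap 0 (R / 2) t, p)) (0, e) := by
    refine HolAt.parametric_integral (Φ := fun w : ℂ × ℂ × E =>
      (w.1 - w.2.1)⁻¹ • (G (w.1, w.2.2) - G (0, w.2.2)))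
      (continuous_circleMap 0 (R / 2)) Real.two_pi_pos.le fun t _ => ?_
    have hz : circleMap 0 (R / 2) t ∈ Metric.ball (0 : ℂ) R := by
      simp [abs_of_pos hr0, hr]
    have hne : circleMap 0 (R / 2) t - 0 ≠ 0 := by
      simpa using hR.ne'
    have hA : HolAt (fun w : ℂ × ℂ × E => G (w.1, w.2.2)) (circleMap 0 (R / 2) t, 0, e) :=
      (hd' _ hz e (Metric.mem_ball_self hR)).comp (g := G) (f := fun w : ℂ × ℂ × E => (w.1, w.2.2))
        (Differentiable.holAt (by fun_prop) _)
    have hB : HolAt (fun w : ℂ × ℂ × E => G (0, w.2.2)) (circleMap 0 (R / 2) t, 0, e) :=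
      (hd' _ (Metric.mem_ball_self hR) e (Metric.mem_ball_self hR)).comp (g := G)
        (f := fun w : ℂ × ℂ × E => ((0 : ℂ), w.2.2)) (Differentiable.holAt (by fun_prop) _)
    have hc : ContinuousAt (fun w : ℂ × ℂ × E => w.1 - w.2.1) (circleMap 0 (R / 2) t, 0, e) := by
      fun_prop
    filter_upwards [hA, hB, hc.eventually_ne hne] with w h1 h2 h3
    have h4 : DifferentiableAt ℂ (fun w : ℂ × ℂ × E => w.1 - w.2.1) w := by fun_prop
    exact (h4.inv h3).smul (h1.sub h2)
  have hnear : ∀ᶠ p : ℂ × E in 𝓝 (0, e), p ∈ Metric.ball (0 : ℂ) (R / 2) ×ˢ Metric.ball e R :=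
    prod_mem_nhds (Metric.ball_mem_nhds _ hr0) (Metric.ball_mem_nhds _ hR)
  have key2 : HolAt (fun p : ℂ × E => (2 * Real.pi : ℂ)⁻¹ • ∫ t in (0 : ℝ)..(2 * Real.pi),
      (fun w : ℂ × ℂ × E => (w.1 - w.2.1)⁻¹ • (G (w.1, w.2.2) - G (0, w.2.2)))
        (circleMap 0 (R / 2) t, p)) (0, e) := key.mono fun _ h => h.const_smul _
  refine key2.congr ?_
  filter_upwards [hnear] with p hp
  have hdiff : DifferentiableOn ℂ (_root_.dslope (fun t => G (t, p.2)) 0) (Metric.ball 0 R) := by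
    rw [Complex.differentiableOn_dslope (Metric.ball_mem_nhds _ hR)]
    intro z hz
    exact ((hd' z hz p.2 hp.2).differentiableAt.comp z
      (f := fun t : ℂ => (t, p.2)) (by fun_prop)).differentiableWithinAt
  have hcau := (hdiff.mono (Metric.closedBall_subset_ball hr)).circleIntegral_sub_inv_smul hp.1
  have hI : (∮ z in C(0, R / 2), (z - p.1)⁻¹ • _root_.dslope (fun t => G (t, p.2)) 0 z) =
      Complex.I • ∫ t in (0 : ℝ)..(2 * Real.pi), (circleMap 0 (R / 2) t - p.1)⁻¹ •
        (G (circleMap 0 (R / 2) t, p.2) - G (0, p.2)) := by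
    rw [circleIntegral, ← intervalIntegral.integral_smul]
    congr 1
    ext t
    have hne : circleMap 0 (R / 2) t ≠ 0 := by simpa using hR.ne'
    have h0 := sub_smul_dslope (fun t => G (t, p.2)) 0 (circleMap 0 (R / 2) t)
    simp only [sub_zero] at h0
    rw [← h0, deriv_circleMap]
    simp only [smul_smul]
    congr 1
    ring
  rw [hI] at hcau
  have hpi : (Real.pi : ℂ) ≠ 0 := by exact_mod_cast Real.pi_ne_zero
  have h5 : (2 * Real.pi * Complex.I : ℂ) ≠ 0 := by
    simp [hpi]
  have h6 : _root_.dslope (fun t => G (t, p.2)) 0 p.1 =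
      (2 * Real.pi * Complex.I : ℂ)⁻¹ • ((2 * Real.pi * Complex.I : ℂ) •
        _root_.dslope (fun t => G (t, p.2)) 0 p.1) := (inv_smul_smul₀ h5 _).symm
  rw [h6, ← hcau, smul_smul]
  congr 1
  field_simp

end Regularity

/-! ### The model equation `x w' + N w = h`. -/

section RadialAverage

variable {E : Type*} [NormedAddCommGroup E] [NormedSpace ℂ E]

/-- The solution `w` of `x w' + N w = h` that is bounded at the origin. -/
noncomputable def radialAverage (N : ℕ) (h : ℂ → E) (x : ℂ) : E :=
  ∫ t in (0 : ℝ)..1, ((t : ℂ) ^ (N - 1)) • h (t * x)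

theorem mul_mem_ball_of_mem_Icc {r : ℝ} {x : ℂ} (hx : x ∈ Metric.ball (0 : ℂ) r) {t : ℝ}
    (ht : t ∈ Set.Icc (0 : ℝ) 1) : (t : ℂ) * x ∈ Metric.ball (0 : ℂ) r := by
  rw [mem_ball_zero_iff] at hx ⊢
  rw [norm_mul, Complex.norm_real, Real.norm_of_nonneg ht.1]
  exact (mul_le_of_le_one_left (norm_nonneg x) ht.2).trans_lt hx

theorem continuousOn_radialAverage_integrand {N : ℕ} {h : ℂ → E} {r : ℝ}
    (hh : ContinuousOn h (Metric.ball 0 r)) {x : ℂ} (hx : x ∈ Metric.ball (0 : ℂ) r) :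
    ContinuousOn (fun t : ℝ => ((t : ℂ) ^ (N - 1)) • h (t * x)) (Set.uIcc 0 1) := by
  refine ContinuousOn.smul (by fun_prop) (hh.comp (by fun_prop) fun t ht => ?_)
  rw [Set.uIcc_of_le zero_le_one] at ht
  exact mul_mem_ball_of_mem_Icc hx ht

theorem radialAverage_sub {N : ℕ} {h k : ℂ → E} {r : ℝ}
    (hh : ContinuousOn h (Metric.ball 0 r)) (hk : ContinuousOn k (Metric.ball 0 r)) {x : ℂ}
    (hx : x ∈ Metric.ball (0 : ℂ) r) :
    radialAverage N h x - radialAverage N k x = radialAverage N (fun y => h y - k y) x := by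
  unfold radialAverage
  rw [← intervalIntegral.integral_sub
    (continuousOn_radialAverage_integrand hh hx).intervalIntegrable
    (continuousOn_radialAverage_integrand hk hx).intervalIntegrable]
  simp only [smul_sub]

/-- The gain of `1 / N`, the integral of `t ^ (N - 1)` over `[0, 1]`, is what makes the fixed point
map a contraction. -/
theorem norm_radialAverage_le {N : ℕ} (hN : 1 ≤ N) {h : ℂ → E} {r C : ℝ}
    (hC : ∀ y ∈ Metric.ball (0 : ℂ) r, ‖h y‖ ≤ C) {x : ℂ} (hx : x ∈ Metric.ball (0 : ℂ) r) :
    ‖radialAverage N h x‖ ≤ C / N := by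
  have h1 : ∫ t in (0 : ℝ)..1, C * t ^ (N - 1) = C / N := by
    rw [intervalIntegral.integral_const_mul, integral_pow]
    have : ((N - 1 : ℕ) : ℝ) + 1 = N := by
      rw [Nat.cast_sub hN]; simp
    rw [this, Nat.sub_add_cancel hN]
    simp [zero_pow (by omega : N ≠ 0), div_eq_mul_inv]
  rw [← h1]
  refine intervalIntegral.norm_integral_le_of_norm_le zero_le_one
    (Eventually.of_forall fun t ht => ?_) (Continuous.intervalIntegrable (by fun_prop) _ _)
  rw [norm_smul, norm_pow, Complex.norm_real, Real.norm_of_nonneg ht.1.le, mul_comm]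
  exact mul_le_mul_of_nonneg_right (hC _ (mul_mem_ball_of_mem_Icc hx ⟨ht.1.le, ht.2⟩))
    (pow_nonneg ht.1.le _)

variable [CompleteSpace E]

theorem holAt_radialAverage {N : ℕ} {h : ℂ → E} {r : ℝ}
    (hh : DifferentiableOn ℂ h (Metric.ball 0 r)) {x : ℂ} (hx : x ∈ Metric.ball (0 : ℂ) r) :
    HolAt (radialAverage N h) x := by
  refine HolAt.parametric_integral (Φ := fun p : ℂ × ℂ => (p.1 ^ (N - 1)) • h (p.1 * p.2))
    (γ := fun t => (t : ℂ)) Complex.continuous_ofReal zero_le_one fun t ht => ?_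
  have hm : ContinuousAt (fun p : ℂ × ℂ => p.1 * p.2) ((t : ℂ), x) := by fun_prop
  filter_upwards [hm.eventually_mem (Metric.isOpen_ball.mem_nhds (mul_mem_ball_of_mem_Icc hx ht))]
    with p hp
  have h1 : DifferentiableAt ℂ (fun p : ℂ × ℂ => p.1 * p.2) p := by fun_prop
  have h2 : DifferentiableAt ℂ (fun p : ℂ × ℂ => p.1 ^ (N - 1)) p := by fun_prop
  exact h2.smul (((hh.differentiableAt (Metric.isOpen_ball.mem_nhds hp)).comp p h1))

/-- Rescaling gives `τ ^ N • w (τ x) = ∫ s in 0..τ, s ^ (N - 1) • h (s x)` for `τ > 0`; the equation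
is the derivative of this identity at `τ = 1`. -/
theorem radialAverage_equation {N : ℕ} (hN : 1 ≤ N) {h : ℂ → E} {r : ℝ}
    (hh : DifferentiableOn ℂ h (Metric.ball 0 r)) {x : ℂ} (hx : x ∈ Metric.ball (0 : ℂ) r) :
    x • deriv (radialAverage N h) x + (N : ℂ) • radialAverage N h x = h x := by
  set w := radialAverage N h with hw
  have hmem : ∀ᶠ s : ℝ in 𝓝 1, (s : ℂ) * x ∈ Metric.ball (0 : ℂ) r := by
    have hc : ContinuousAt (fun s : ℝ => (s : ℂ) * x) 1 := by fun_prop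
    exact hc.eventually_mem (Metric.isOpen_ball.mem_nhds (by simpa using hx))
  have hcont : ∀ s : ℝ, (s : ℂ) * x ∈ Metric.ball (0 : ℂ) r →
      ContinuousAt (fun s : ℝ => (s : ℂ) ^ (N - 1) • h (s * x)) s := by
    intro s hs
    have h1 : ContinuousAt (fun s : ℝ => (s : ℂ) * x) s := by fun_prop
    have h2 : ContinuousAt (fun s : ℝ => (s : ℂ) ^ (N - 1)) s := by fun_prop
    exact h2.smul (ContinuousAt.comp (g := h) (f := fun s : ℝ => (s : ℂ) * x)
      (hh.differentiableAt (Metric.isOpen_ball.mem_nhds hs)).continuousAt h1)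
  have hF1 : HasDerivAt (fun τ : ℝ => ∫ s in (0 : ℝ)..τ, (s : ℂ) ^ (N - 1) • h (s * x))
      (h x) 1 := by
    have := intervalIntegral.integral_hasDerivAt_right (a := 0) (b := 1)
      (f := fun s : ℝ => (s : ℂ) ^ (N - 1) • h (s * x))
      (continuousOn_radialAverage_integrand hh.continuousOn hx).intervalIntegrable
      (ContinuousAt.stronglyMeasurableAtFilter (s := {s : ℝ | (s : ℂ) * x ∈ Metric.ball (0 : ℂ) r})
        (Metric.isOpen_ball.preimage (by fun_prop)) hcont 1 (by simpa using hx))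
      (hcont 1 (by simpa using hx))
    simpa using this
  have heq : (fun τ : ℝ => (τ : ℂ) ^ N • w (τ * x)) =ᶠ[𝓝 1]
      fun τ : ℝ => ∫ s in (0 : ℝ)..τ, (s : ℂ) ^ (N - 1) • h (s * x) := by
    filter_upwards [lt_mem_nhds (zero_lt_one (α := ℝ))] with τ hτ
    have h1 := intervalIntegral.integral_comp_mul_left (a := 0) (b := 1)
      (fun s : ℝ => (s : ℂ) ^ (N - 1) • h (s * x)) hτ.ne'
    rw [mul_zero, mul_one] at h1
    have h2 : ∫ s in (0 : ℝ)..τ, (s : ℂ) ^ (N - 1) • h (s * x) =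
        (τ : ℂ) • ∫ t in (0 : ℝ)..1, ((τ * t : ℝ) : ℂ) ^ (N - 1) • h ((τ * t : ℝ) * x) := by
      rw [h1, Complex.coe_smul, smul_inv_smul₀ hτ.ne']
    rw [h2, hw, radialAverage, ← intervalIntegral.integral_smul, ← intervalIntegral.integral_smul]
    congr 1
    ext t
    obtain ⟨m, rfl⟩ : ∃ m, N = m + 1 := ⟨N - 1, by omega⟩
    simp only [smul_smul, Nat.add_sub_cancel]
    push_cast
    congr 1
    · ring
    · congr 1; ring
  have hwd : HasDerivAt w (deriv w x) x :=
    (holAt_radialAverage hh hx).differentiableAt.hasDerivAt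
  have hF2 : HasDerivAt (fun τ : ℝ => (τ : ℂ) ^ N • w (τ * x))
      (x • deriv w x + (N : ℂ) • w x) 1 := by
    have h1 : HasDerivAt (fun τ : ℂ => τ * x) x ((1 : ℝ) : ℂ) := by
      simpa using (hasDerivAt_id ((1 : ℝ) : ℂ)).mul_const x
    have h2 : HasDerivAt (fun τ : ℂ => w (τ * x)) (x • deriv w x) ((1 : ℝ) : ℂ) := by
      have h0 : HasDerivAt w (deriv w x) (((1 : ℝ) : ℂ) * x) := by simpa using hwd
      exact HasDerivAt.scomp (h := fun τ : ℂ => τ * x) ((1 : ℝ) : ℂ) h0 h1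
    have h3 : HasDerivAt (fun τ : ℂ => τ ^ N) (N : ℂ) ((1 : ℝ) : ℂ) := by
      simpa using hasDerivAt_pow N ((1 : ℝ) : ℂ)
    have h4 := (h3.fun_smul h2).scomp (1 : ℝ) Complex.ofRealCLM.hasDerivAt
    simpa [Function.comp_def] using h4
  exact hF2.unique (hF1.congr_of_eventuallyEq heq)

end RadialAverage

/-! ### The Briot-Bouquet theorem. -/

section BriotBouquet

variable {E : Type*} [NormedAddCommGroup E] [NormedSpace ℂ E]

/-- `U` is a holomorphic solution, vanishing at the origin, of the Briot-Bouquet system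
`x U' = f (x, U)`. -/
structure IsBBSol (f : ℂ × E → E) (U : ℂ → E) : Prop where
  analytic : AnalyticAt ℂ U 0
  zero : U 0 = 0
  equation : ∀ᶠ x in 𝓝 (0 : ℂ), x • deriv U x = f (x, U x)

/-- The system for `Ũ` obtained from `x U' = f (x, U)` by `U = x (Ũ + e)`. -/
noncomputable def bbShift (f : ℂ × E → E) (e : E) : ℂ × E → E := fun p =>
  dslope (fun t : ℂ => f (t, t • (p.2 + e))) 0 p.1 - (p.2 + e)

/-- `f` is holomorphic at the origin and `f (0, u) = A u`. -/
structure BBForm (f : ℂ × E → E) (A : E →L[ℂ] E) : Prop where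
  hol : HolAt f 0
  lin : ∀ᶠ u in 𝓝 (0 : E), f (0, u) = A u

variable {f : ℂ × E → E} {A : E →L[ℂ] E} {U V : ℂ → E}

theorem BBForm.map_zero (hf : BBForm f A) : f 0 = 0 := by
  have h : f ((0 : ℂ), (0 : E)) = 0 := by simpa using hf.lin.self_of_nhds
  exact h

theorem BBForm.fderiv_apply (hf : BBForm f A) (u : E) : fderiv ℂ f 0 (0, u) = A u := by
  have h1 : HasFDerivAt (fun u : E => f (0, u))
      ((fderiv ℂ f 0).comp (ContinuousLinearMap.inr ℂ ℂ E)) 0 :=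
    hf.hol.differentiableAt.hasFDerivAt.comp (0 : E) (hasFDerivAt_prodMk_right 0 0)
  have h2 : HasFDerivAt (fun u : E => f (0, u)) A 0 :=
    A.hasFDerivAt.congr_of_eventuallyEq hf.lin
  have := congrArg (fun L => L u) (h1.unique h2)
  simpa using this

theorem BBForm.fderiv_apply' (hf : BBForm f A) (x : ℂ) (u : E) :
    fderiv ℂ f 0 (x, u) = x • fderiv ℂ f 0 (1, 0) + A u := by
  rw [← hf.fderiv_apply, ← map_smul, ← map_add]
  simp

variable [CompleteSpace E]

/-- At `x = 0` the new system equals `A u - u` plus the left side of `he`. Thus `he` is just the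
condition that the origin be a zero again, and linearity on `x = 0` persists exactly, without
higher-order terms. -/
theorem BBForm.shift (hf : BBForm f A) {e : E}
    (he : fderiv ℂ f 0 (1, 0) + A e - e = 0) :
    BBForm (bbShift f e) (A - ContinuousLinearMap.id ℂ E) where
  hol := by
    have hG : HolAt (fun p : ℂ × E => f (p.1, p.1 • (p.2 + e))) (0, 0) := by
      refine HolAt.comp (g := f) (f := fun p : ℂ × E => (p.1, p.1 • (p.2 + e))) ?_
        (Differentiable.holAt (by fun_prop) _)
      have h0 : ((0 : ℂ), (0 : ℂ) • ((0 : E) + e)) = 0 := by simp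
      rw [h0]
      exact hf.hol
    have := hG.dslope
    filter_upwards [this] with p hp
    exact hp.sub (by fun_prop)
  lin := by
    refine Eventually.of_forall fun u => ?_
    have h1 : HasDerivAt (fun t : ℂ => (t, t • (u + e))) (1, u + e) 0 := by
      simpa using (hasDerivAt_id (0 : ℂ)).prodMk ((hasDerivAt_id (0 : ℂ)).smul_const (u + e))
    have h2 : HasDerivAt (fun t : ℂ => f (t, t • (u + e))) (fderiv ℂ f 0 (1, u + e)) 0 := by
      refine HasFDerivAt.comp_hasDerivAt (0 : ℂ) (f := fun t : ℂ => (t, t • (u + e))) ?_ h1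
      have h0 : ((0 : ℂ), (0 : ℂ) • (u + e)) = 0 := by simp
      rw [h0]
      exact hf.hol.differentiableAt.hasFDerivAt
    simp only [bbShift, dslope_same, h2.deriv]
    rw [hf.fderiv_apply']
    have : A u - u + (fderiv ℂ f 0 (1, 0) + A e - e) = A u - u := by rw [he, add_zero]
    simp only [sub_apply, ContinuousLinearMap.id_apply]
    rw [← this, map_add]
    module

theorem IsBBSol.of_shift (hf : BBForm f A) {e : E} (hU : IsBBSol (bbShift f e) U) :
    IsBBSol f (fun x => x • (U x + e)) where
  analytic := analyticAt_id.smul (hU.analytic.add analyticAt_const)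
  zero := by simp
  equation := by
    filter_upwards [hU.equation, hU.analytic.eventually_analyticAt] with x hx hxa
    have h1 : HasDerivAt (fun x => x • (U x + e)) (x • deriv U x + (1 : ℂ) • (U x + e)) x :=
      (hasDerivAt_id x).smul (hxa.differentiableAt.hasDerivAt.add_const e)
    rw [h1.deriv, hx, bbShift]
    have h2 := sub_smul_dslope (fun t : ℂ => f (t, t • (U x + e))) 0 x
    have h3 : f ((0 : ℂ), (0 : E)) = 0 := hf.map_zero
    simp only [sub_zero, zero_smul, h3] at h2
    simp only [one_smul, sub_add_cancel]
    exact h2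

/-- Comparison of the coefficients of `x` in `x U' = f (x, U)`. At an eigenvalue `1` of `A` this
becomes the obstruction. -/
theorem IsBBSol.coeff (hf : BBForm f A) (hU : IsBBSol f U) :
    fderiv ℂ f 0 (1, 0) + A (deriv U 0) - deriv U 0 = 0 := by
  have h1 : HasDerivAt (fun x => x • deriv U x) (deriv U 0) 0 := by
    simpa using (hasDerivAt_id (0 : ℂ)).fun_smul hU.analytic.deriv.differentiableAt.hasDerivAt
  have h2 : HasDerivAt (fun x => f (x, U x)) (fderiv ℂ f 0 (1, deriv U 0)) 0 := by
    refine HasFDerivAt.comp_hasDerivAt (0 : ℂ) (f := fun x : ℂ => (x, U x)) ?_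
      ((hasDerivAt_id (0 : ℂ)).prodMk hU.analytic.differentiableAt.hasDerivAt)
    rw [hU.zero]
    exact hf.hol.differentiableAt.hasFDerivAt
  have h3 := (h1.congr_of_eventuallyEq (hU.equation.mono fun _ h => h.symm)).unique h2
  rw [hf.fderiv_apply', one_smul] at h3
  rw [← h3, sub_self]

/-- Converse of `IsBBSol.of_shift`: the shift vector has to be `U' 0`, and `IsBBSol.coeff` makes it
admissible. -/
theorem IsBBSol.to_shift (hf : BBForm f A) (hU : IsBBSol f U) :
    IsBBSol (bbShift f (deriv U 0)) (fun x => dslope U 0 x - deriv U 0) := by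
  have hD : AnalyticAt ℂ (dslope U 0) 0 := by
    obtain ⟨p, hp⟩ := hU.analytic
    exact hp.has_fpower_series_dslope_fslope.analyticAt
  refine ⟨hD.sub analyticAt_const, by simp, ?_⟩
  have hUx : ∀ x, U x = x • dslope U 0 x := fun x => by
    simpa [hU.zero] using (sub_smul_dslope U 0 x).symm
  filter_upwards [hU.equation, hD.eventually_analyticAt] with x hx hxa
  rcases eq_or_ne x 0 with rfl | hx0
  · have := (hf.shift (hU.coeff hf)).map_zero
    simp only [zero_smul, dslope_same, sub_self]
    exact this.symm
  · have hderiv : HasDerivAt U (x • deriv (dslope U 0) x + (1 : ℂ) • dslope U 0 x) x := by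
      refine ((hasDerivAt_id x).smul hxa.differentiableAt.hasDerivAt).congr_of_eventuallyEq ?_
      exact Eventually.of_forall hUx
    rw [hderiv.deriv, hUx x] at hx
    have h2 := sub_smul_dslope (fun t : ℂ => f (t, t • dslope U 0 x)) 0 x
    have h3 : f ((0 : ℂ), (0 : E)) = 0 := hf.map_zero
    simp only [sub_zero, zero_smul, h3] at h2
    rw [← h2] at hx
    have hx' := smul_right_injective E hx0 hx
    rw [deriv_sub_const, bbShift]
    simp only [sub_add_cancel]
    rw [← hx', one_smul, add_sub_cancel_right]

/-- Holomorphic solutions are unique when no positive integer is an eigenvalue. -/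
theorem IsBBSol.eventuallyEq (hf : BBForm f A)
    (hA : ∀ k : ℕ, 1 ≤ k → ∀ u, A u = (k : ℂ) • u → u = 0) (hU : IsBBSol f U)
    (hV : IsBBSol f V) : U =ᶠ[𝓝 0] V := by
  have hW : AnalyticAt ℂ (fun x => U x - V x) 0 := hU.analytic.sub hV.analytic
  by_contra hne
  have hne' : ¬ ∀ᶠ x in 𝓝 (0 : ℂ), U x - V x = 0 := fun h =>
    hne (h.mono fun x hx => sub_eq_zero.1 hx)
  -- Write `U - V = x ^ n • g` with `g 0 ≠ 0`. Strict differentiability gives `x (U - V)' - A (U -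
  -- V) = o(U - V)`; division by `x ^ n` leaves `A (g 0) = n • g 0`, which is excluded.
  obtain ⟨n, g, hg, hg0, hgW⟩ := hW.exists_eventuallyEq_pow_smul_nonzero_iff.2 hne'
  simp only [sub_zero] at hgW
  have hn : 1 ≤ n := by
    by_contra hn
    have hn0 : n = 0 := by omega
    have := hgW.self_of_nhds
    simp [hn0, hU.zero, hV.zero] at this
    exact hg0 this.symm
  refine hg0 (hA n hn _ ?_)
  have hlo := hf.hol.hasStrictFDerivAt.isLittleO
  have hUc := hU.analytic.continuousAt
  have hVc := hV.analytic.continuousAt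
  have hten : Tendsto (fun x : ℂ => ((x, U x), (x, V x))) (𝓝 0)
      (𝓝 ((0 : ℂ × E), (0 : ℂ × E))) := by
    have : ContinuousAt (fun x : ℂ => ((x, U x), (x, V x))) 0 := by fun_prop
    rw [ContinuousAt, hU.zero, hV.zero] at this
    exact this
  have h1 : (fun x => f (x, U x) - f (x, V x) - A (U x - V x)) =o[𝓝 0] fun x => U x - V x := by
    have h2 := hlo.comp_tendsto hten
    refine (h2.congr_left fun x => ?_).trans_isBigO ?_
    · have h0 : (x, U x) - (x, V x) = ((0 : ℂ), U x - V x) := by simp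
      simp only [Function.comp_apply, h0, hf.fderiv_apply]
    · refine Asymptotics.IsBigO.of_bound 1 (Eventually.of_forall fun x => ?_)
      simp
  have h3 : (fun x : ℂ => x ^ n • ((n : ℂ) • g x + x • deriv g x - A (g x))) =o[𝓝 0]
      fun x : ℂ => x ^ n • g x := by
    refine h1.congr' ?_ hgW
    filter_upwards [hgW.eventually_nhds, hU.equation, hV.equation, hg.eventually_analyticAt,
      hU.analytic.eventually_analyticAt, hV.analytic.eventually_analyticAt] with x h4 h5 h6 h7 h8 h9
    have h4' := h4.self_of_nhds
    have h11 : deriv U x - deriv V x = deriv (fun x => x ^ n • g x) x := by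
      rw [← deriv_fun_sub h8.differentiableAt h9.differentiableAt]
      exact EventuallyEq.deriv_eq h4
    rw [← h5, ← h6, h4', ← smul_sub, h11]
    have h10 : HasDerivAt (fun x => x ^ n • g x)
        (x ^ n • deriv g x + ((n : ℂ) * x ^ (n - 1)) • g x) x :=
      (hasDerivAt_pow n x).smul h7.differentiableAt.hasDerivAt
    rw [h10.deriv, map_smul]
    obtain ⟨m, rfl⟩ : ∃ m, n = m + 1 := ⟨n - 1, by omega⟩
    simp only [Nat.add_sub_cancel]
    module
  have h4 : (fun x : ℂ => (n : ℂ) • g x + x • deriv g x - A (g x)) =o[𝓝[≠] 0] g := by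
    have h5 := h3.mono (nhdsWithin_le_nhds (s := {0}ᶜ))
    have h6 := (Asymptotics.isBigO_refl (fun x : ℂ => (x ^ n)⁻¹) (𝓝[≠] 0)).smul_isLittleO h5
    refine h6.congr' ?_ ?_ <;>
    · filter_upwards [self_mem_nhdsWithin] with x hx
      exact inv_smul_smul₀ (pow_ne_zero n hx) _
  have h5 : Tendsto (fun x : ℂ => (n : ℂ) • g x + x • deriv g x - A (g x)) (𝓝[≠] 0) (𝓝 0) := by
    have h6 : g =O[𝓝[≠] 0] fun _ => (1 : ℝ) :=
      (hg.continuousAt.mono_left nhdsWithin_le_nhds).isBigO_one ℝ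
    exact (Asymptotics.isLittleO_one_iff ℝ).1 (h4.trans_isBigO h6)
  have h6 : Tendsto (fun x : ℂ => (n : ℂ) • g x + x • deriv g x - A (g x)) (𝓝[≠] 0)
      (𝓝 ((n : ℂ) • g 0 + (0 : ℂ) • deriv g 0 - A (g 0))) := by
    have h7 : ContinuousAt (fun x : ℂ => (n : ℂ) • g x + x • deriv g x - A (g x)) 0 := by
      have := hg.continuousAt
      have := hg.deriv.continuousAt
      fun_prop
    exact h7.tendsto.mono_left nhdsWithin_le_nhds
  have h7 := tendsto_nhds_unique h6 h5
  rw [zero_smul, add_zero, sub_eq_zero] at h7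
  exact h7.symm

/-- Existence for `x U' + N U = g (x, U)` when `g` has a Lipschitz constant less than `N`
in `U`. -/
theorem exists_sol_of_norm_lt {g : ℂ × E → E} (hg : HolAt g 0) (hg0 : g 0 = 0)
    {N : ℕ} (hN : ‖(fderiv ℂ g 0).comp (ContinuousLinearMap.inr ℂ ℂ E)‖ < N) :
    ∃ U : ℂ → E, AnalyticAt ℂ U 0 ∧ U 0 = 0 ∧
      ∀ᶠ x in 𝓝 (0 : ℂ), x • deriv U x + (N : ℂ) • U x = g (x, U x) := by
  set B := (fderiv ℂ g 0).comp (ContinuousLinearMap.inr ℂ ℂ E) with hB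
  obtain ⟨K, hBK, hKN⟩ := exists_between hN
  have hK0 : 0 ≤ K := (norm_nonneg _).trans hBK.le
  have hN0 : (0 : ℝ) < N := hK0.trans_lt hKN
  have hN1 : 1 ≤ N := by exact_mod_cast hN0
  obtain ⟨ρ, hρ, hdiff, hlip⟩ : ∃ ρ > 0,
      (∀ x ∈ Metric.ball (0 : ℂ) ρ, ∀ u ∈ Metric.ball (0 : E) ρ, DifferentiableAt ℂ g (x, u)) ∧
      (∀ x ∈ Metric.ball (0 : ℂ) ρ, ∀ u ∈ Metric.ball (0 : E) ρ, ∀ v ∈ Metric.ball (0 : E) ρ,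
        ‖g (x, u) - g (x, v)‖ ≤ K * ‖u - v‖) := by
    have h1 := hg.hasStrictFDerivAt.isLittleO.def (sub_pos.2 hBK)
    rw [nhds_prod_eq, eventually_prod_self_iff'] at h1
    obtain ⟨t, ht, h1⟩ := h1
    obtain ⟨ρ, hρ, h2⟩ := Metric.mem_nhds_iff.1 (inter_mem ht hg)
    have h3 : ∀ x ∈ Metric.ball (0 : ℂ) ρ, ∀ u ∈ Metric.ball (0 : E) ρ,
        (x, u) ∈ Metric.ball (0 : ℂ × E) ρ := fun x hx u hu => by
      rw [mem_ball_zero_iff] at hx hu ⊢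
      exact max_lt hx hu
    refine ⟨ρ, hρ, fun x hx u hu => (h2 (h3 x hx u hu)).2, fun x hx u hu v hv => ?_⟩
    have h4 := h1 _ (h2 (h3 x hx u hu)).1 _ (h2 (h3 x hx v hv)).1
    have h5 : (x, u) - (x, v) = ((0 : ℂ), u - v) := by simp
    simp only [h5] at h4
    have h6 : fderiv ℂ g 0 (0, u - v) = B (u - v) := by simp [hB]
    have h7 : ‖((0 : ℂ), u - v)‖ = ‖u - v‖ := by simp
    rw [h6, h7] at h4
    have h8 := B.le_opNorm (u - v)
    have h9 := norm_sub_norm_le (g (x, u) - g (x, v)) (B (u - v))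
    linarith
  set σ := ρ / 2 with hσ
  have hσ0 : 0 < σ := by positivity
  have hσρ : σ < ρ := by rw [hσ]; linarith
  -- The bound `(N - K) σ` leaves room for the Lipschitz part `K σ`: together they give `N σ`, which
  -- the radial average turns back into `σ`.
  obtain ⟨r, hr, hrρ, hsmall⟩ : ∃ r > 0, r ≤ ρ ∧
      ∀ x ∈ Metric.ball (0 : ℂ) r, ‖g (x, 0)‖ ≤ (N - K) * σ := by
    have hc : ContinuousAt (fun x : ℂ => g (x, 0)) 0 :=
      ContinuousAt.comp (g := g) (f := fun x : ℂ => (x, (0 : E)))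
        hg.differentiableAt.continuousAt (by fun_prop)
    have h1 : ∀ᶠ x in 𝓝 (0 : ℂ), ‖g (x, 0)‖ < (N - K) * σ := by
      refine hc.norm.eventually_lt_const ?_
      have : g ((0 : ℂ), (0 : E)) = 0 := hg0
      simp only [this, norm_zero]
      exact mul_pos (by linarith) hσ0
    obtain ⟨r, hr, h2⟩ := Metric.eventually_nhds_iff_ball.1 h1
    exact ⟨min r ρ, lt_min hr hρ, min_le_right _ _, fun x hx =>
      (h2 x (Metric.ball_subset_ball (min_le_left _ _) hx)).le⟩
  have hball : Metric.ball (0 : ℂ) r ⊆ Metric.ball (0 : ℂ) ρ := Metric.ball_subset_ball hrρ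
  -- The Picard iteration of `T` runs in `S`, with ratio `K / N < 1`; the uniform limit is again
  -- holomorphic.
  let S : Set (ℂ → E) := {u | DifferentiableOn ℂ u (Metric.ball 0 r) ∧
    ∀ x ∈ Metric.ball (0 : ℂ) r, ‖u x‖ ≤ σ}
  let T : (ℂ → E) → ℂ → E := fun u => radialAverage N fun x => g (x, u x)
  have hSρ : ∀ u ∈ S, ∀ x ∈ Metric.ball (0 : ℂ) r, u x ∈ Metric.ball (0 : E) ρ :=
    fun u hu x hx => mem_ball_zero_iff.2 ((hu.2 x hx).trans_lt hσρ)
  have hcomp : ∀ u ∈ S, DifferentiableOn ℂ (fun x => g (x, u x)) (Metric.ball 0 r) := by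
    intro u hu x hx
    have h1 := hu.1.differentiableAt (Metric.isOpen_ball.mem_nhds hx)
    exact ((hdiff x (hball hx) _ (hSρ u hu x hx)).comp x
      (f := fun x => (x, u x)) (differentiableAt_id.prodMk h1)).differentiableWithinAt
  have hTS : ∀ u ∈ S, T u ∈ S := by
    refine fun u hu => ⟨fun x hx =>
      (holAt_radialAverage (hcomp u hu) hx).differentiableAt.differentiableWithinAt,
      fun x hx => ?_⟩
    have h1 : ∀ y ∈ Metric.ball (0 : ℂ) r, ‖g (y, u y)‖ ≤ N * σ := by
      intro y hy
      have h2 := hlip y (hball hy) _ (hSρ u hu y hy) 0 (Metric.mem_ball_self hρ)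
      have h3 := hsmall y hy
      have h4 := hu.2 y hy
      have h5 := norm_sub_norm_le (g (y, u y)) (g (y, 0))
      rw [sub_zero] at h2
      nlinarith
    refine (norm_radialAverage_le hN1 h1 hx).trans (le_of_eq ?_)
    field_simp
  have hTlip : ∀ u ∈ S, ∀ v ∈ S, ∀ C : ℝ, (∀ x ∈ Metric.ball (0 : ℂ) r, ‖u x - v x‖ ≤ C) →
      ∀ x ∈ Metric.ball (0 : ℂ) r, ‖T u x - T v x‖ ≤ K / N * C := by
    intro u hu v hv C hC x hx
    simp only [T]
    rw [radialAverage_sub (hcomp u hu).continuousOn (hcomp v hv).continuousOn hx]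
    have h1 : ∀ y ∈ Metric.ball (0 : ℂ) r, ‖g (y, u y) - g (y, v y)‖ ≤ K * C := fun y hy =>
      (hlip y (hball hy) _ (hSρ u hu y hy) _ (hSρ v hv y hy)).trans
        (mul_le_mul_of_nonneg_left (hC y hy) hK0)
    exact (norm_radialAverage_le hN1 h1 hx).trans (le_of_eq (by ring))
  set κ := K / N with hκ
  have hκ0 : 0 ≤ κ := by positivity
  have hκ1 : κ < 1 := (div_lt_one hN0).2 hKN
  let u : ℕ → ℂ → E := fun n => T^[n] 0
  have hu_succ : ∀ n, u (n + 1) = T (u n) := fun n => Function.iterate_succ_apply' T n 0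
  have huS : ∀ n, u n ∈ S := by
    intro n
    induction n with
    | zero => exact ⟨differentiableOn_const (0 : E), fun x _ => by simpa [u] using hσ0.le⟩
    | succ n ih => rw [hu_succ]; exact hTS _ ih
  have hstep : ∀ n, ∀ x ∈ Metric.ball (0 : ℂ) r, ‖u n x - u (n + 1) x‖ ≤ σ * κ ^ n := by
    intro n
    induction n with
    | zero => intro x hx; simpa [u] using (huS 1).2 x hx
    | succ n ih =>
      intro x hx
      rw [hu_succ n, hu_succ (n + 1)]
      exact (hTlip _ (huS n) _ (huS (n + 1)) _ ih x hx).trans (le_of_eq (by ring))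
  have hlim : ∀ x, ∃ y, x ∈ Metric.ball (0 : ℂ) r → Tendsto (fun n => u n x) atTop (𝓝 y) := by
    intro x
    by_cases hx : x ∈ Metric.ball (0 : ℂ) r
    · have hc : CauchySeq fun n => u n x :=
        cauchySeq_of_le_geometric κ σ hκ1 fun n => by
          rw [dist_eq_norm]; exact hstep n x hx
      obtain ⟨y, hy⟩ := cauchySeq_tendsto_of_complete hc
      exact ⟨y, fun _ => hy⟩
    · exact ⟨0, fun h => absurd h hx⟩
  choose U hUlim using hlim
  have hrate : ∀ n, ∀ x ∈ Metric.ball (0 : ℂ) r, ‖u n x - U x‖ ≤ σ * κ ^ n / (1 - κ) := by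
    intro n x hx
    rw [← dist_eq_norm]
    exact dist_le_of_le_geometric_of_tendsto κ σ hκ1
      (fun n => by rw [dist_eq_norm]; exact hstep n x hx) (hUlim x hx) n
  have hrate0 : Tendsto (fun n : ℕ => σ * κ ^ n / (1 - κ)) atTop (𝓝 0) := by
    have := ((tendsto_pow_atTop_nhds_zero_of_lt_one hκ0 hκ1).const_mul σ).div_const (1 - κ)
    simpa using this
  have hunif : TendstoUniformlyOn u U atTop (Metric.ball 0 r) := by
    rw [Metric.tendstoUniformlyOn_iff]
    intro ε hε
    filter_upwards [hrate0.eventually_lt_const hε] with n hn x hx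
    rw [dist_comm, dist_eq_norm]
    exact (hrate n x hx).trans_lt hn
  have hUd : DifferentiableOn ℂ U (Metric.ball 0 r) :=
    hunif.tendstoLocallyUniformlyOn.differentiableOn
      (Eventually.of_forall fun n => (huS n).1) Metric.isOpen_ball
  have hUS : U ∈ S := ⟨hUd, fun x hx =>
    le_of_tendsto (hUlim x hx).norm (Eventually.of_forall fun n => (huS n).2 x hx)⟩
  have hfix : ∀ x ∈ Metric.ball (0 : ℂ) r, T U x = U x := by
    intro x hx
    have h1 : Tendsto (fun n => u (n + 1) x) atTop (𝓝 (T U x)) := by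
      rw [tendsto_iff_norm_sub_tendsto_zero]
      refine squeeze_zero (fun _ => norm_nonneg _) (fun n => ?_)
        (by simpa using hrate0.const_mul κ)
      rw [hu_succ]
      exact hTlip _ (huS n) _ hUS _ (hrate n) x hx
    exact tendsto_nhds_unique h1 ((tendsto_add_atTop_iff_nat 1).2 (hUlim x hx))
  have hev : ∀ x ∈ Metric.ball (0 : ℂ) r, T U =ᶠ[𝓝 x] U := fun x hx =>
    Filter.mem_of_superset (Metric.isOpen_ball.mem_nhds hx) hfix
  have heq : ∀ x ∈ Metric.ball (0 : ℂ) r, x • deriv U x + (N : ℂ) • U x = g (x, U x) := by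
    intro x hx
    rw [← (hev x hx).deriv_eq, ← hfix x hx, radialAverage_equation hN1 (hcomp U hUS) hx,
      hfix x hx]
  refine ⟨U, hUd.analyticAt (Metric.ball_mem_nhds _ hr), ?_,
    Filter.mem_of_superset (Metric.ball_mem_nhds _ hr) heq⟩
  -- At `x = 0` the equation reads `N U(0) = g (0, U 0)`, and the Lipschitz constant `K < N` forces
  -- `U 0 = 0`.
  have h0 := heq 0 (Metric.mem_ball_self hr)
  have h00 : g ((0 : ℂ), (0 : E)) = 0 := hg0
  have h1 := hlip 0 (Metric.mem_ball_self hρ) _ (hSρ U hUS 0 (Metric.mem_ball_self hr)) 0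
    (Metric.mem_ball_self hρ)
  rw [h00, ← h0] at h1
  simp only [zero_smul, zero_add, sub_zero, norm_smul, Complex.norm_natCast] at h1
  by_contra hne
  have := norm_pos_iff.2 hne
  nlinarith

/-- The theorem of Briot and Bouquet: a holomorphic solution exists when `A - k` is onto for all
positive integers `k`. -/
theorem BBForm.exists_sol (hf : BBForm f A)
    (hA : ∀ k : ℕ, 1 ≤ k → ∀ v, ∃ u, A u - (k : ℂ) • u = v) : ∃ U, IsBBSol f U := by
  -- Here `j` counts the shifts made and `i` those to come. After `N` shifts, moving `N U` to the
  -- left restores `A` as the `U`-derivative of the right-hand side, of norm below `N`.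
  obtain ⟨N, hN⟩ := exists_nat_gt ‖A‖
  suffices h : ∀ i j : ℕ, i + j = N → ∀ f : ℂ × E → E,
      BBForm f (A - (j : ℂ) • ContinuousLinearMap.id ℂ E) → ∃ U, IsBBSol f U by
    exact h N 0 rfl f (by simpa using hf)
  intro i
  induction i with
  | zero =>
    intro j hj f hf
    obtain rfl : j = N := by omega
    have hd : HasFDerivAt (fun p : ℂ × E => f p + (j : ℂ) • p.2)
        (fderiv ℂ f 0 + (j : ℂ) • ContinuousLinearMap.snd ℂ ℂ E) 0 :=
      hf.hol.differentiableAt.hasFDerivAt.add (hasFDerivAt_snd.const_smul (j : ℂ))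
    obtain ⟨U, h1, h2, h3⟩ := exists_sol_of_norm_lt (g := fun p : ℂ × E => f p + (j : ℂ) • p.2)
      (N := j) (hf.hol.mono fun p hp => hp.add (by fun_prop)) (by simp [hf.map_zero]) (by
        have : (fderiv ℂ (fun p : ℂ × E => f p + (j : ℂ) • p.2) 0).comp
            (ContinuousLinearMap.inr ℂ ℂ E) = A := by
          ext u
          rw [hd.fderiv]
          simp [hf.fderiv_apply]
        rwa [this])
    exact ⟨U, h1, h2, h3.mono fun x hx => by simpa using hx⟩
  | succ i ih =>
    intro j hj f hf
    obtain ⟨e, he⟩ := hA (j + 1) (by omega) (-fderiv ℂ f 0 (1, 0))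
    have hs := hf.shift (e := e) (by
      rw [← neg_eq_iff_eq_neg] at he
      rw [← he]
      simp only [sub_apply, smul_apply,
        ContinuousLinearMap.id_apply]
      push_cast
      module)
    obtain ⟨U, hU⟩ := ih (j + 1) (by omega) (bbShift f e) (by
      convert hs using 1
      push_cast
      module)
    exact ⟨_, hU.of_shift hf⟩

end BriotBouquet

/-! ### The holomorphic inverse function theorem. -/

section LocalInverse

variable {E F : Type*} [NormedAddCommGroup E] [NormedSpace ℂ E] [CompleteSpace E]
  [NormedAddCommGroup F] [NormedSpace ℂ F]

theorem HolAt.exists_localInverse {f : E → F} {p : E} (hf : HolAt f p) (f' : E ≃L[ℂ] F)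
    (hf' : HasFDerivAt f (f' : E →L[ℂ] F) p) :
    ∃ g : F → E, HolAt g (f p) ∧ g (f p) = p ∧ (∀ᶠ x in 𝓝 p, g (f x) = x) ∧
      (∀ᶠ y in 𝓝 (f p), f (g y) = y) ∧ HasFDerivAt g (f'.symm : F →L[ℂ] E) (f p) := by
  have hs : HasStrictFDerivAt f (f' : E →L[ℂ] F) p :=
    hf.contDiffAt.hasStrictFDerivAt' hf' one_ne_zero
  have hc : ContDiffAt ℂ 1 (hs.localInverse f f' p) (f p) :=
    hf.contDiffAt.to_localInverse hf' one_ne_zero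
  refine ⟨hs.localInverse f f' p, ?_, hs.localInverse_apply_image, hs.eventually_left_inverse,
    hs.eventually_right_inverse, hs.to_localInverse.hasFDerivAt⟩
  exact (hc.eventually (by simp)).mono fun q hq => hq.differentiableAt one_ne_zero

end LocalInverse

/-! ### Linearization of one-dimensional holomorphic fields. -/

section Linearization

/-- A holomorphic vector field on the line with a simple zero is holomorphically linearizable. -/
theorem exists_linearization {g : ℂ → ℂ} (hg : AnalyticAt ℂ g 0) (hg0 : g 0 = 0)
    (ha : deriv g 0 ≠ 0) :
    ∃ ψ χ : ℂ → ℂ, AnalyticAt ℂ ψ 0 ∧ AnalyticAt ℂ χ 0 ∧ ψ 0 = 0 ∧ χ 0 = 0 ∧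
      (∀ᶠ x in 𝓝 0, χ (ψ x) = x) ∧ (∀ᶠ ζ in 𝓝 0, ψ (χ ζ) = ζ) ∧
      ∀ᶠ ζ in 𝓝 0, g (χ ζ) = deriv χ ζ * (deriv g 0 * ζ) := by
  set a := deriv g 0 with ha_def
  set k := dslope g 0 with hk
  have hdsl : ∀ {f : ℂ → ℂ}, AnalyticAt ℂ f 0 → AnalyticAt ℂ (dslope f 0) 0 := by
    rintro f ⟨p, hp⟩
    exact hp.has_fpower_series_dslope_fslope.analyticAt
  have hka : AnalyticAt ℂ k 0 := hdsl hg
  have hk0 : k 0 = a := dslope_same g 0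
  have hgk : ∀ x, g x = x * k x := fun x => by
    simpa [hg0] using (sub_smul_dslope g 0 x).symm
  have hkk : ∀ x, x * dslope k 0 x = k x - a := fun x => by
    simpa [hk0] using sub_smul_dslope k 0 x
  -- With `ψ = x exp P` and `g = x k`, the condition `ψ' g = a ψ` becomes `(1 + x P') k = a`, that
  -- is, `P' = -(k - a) / (x k)`; this is holomorphic at `0` and has a primitive on a disc.
  have hm : AnalyticAt ℂ (fun x => -dslope k 0 x / k x) 0 :=
    (hdsl hka).neg.div hka (by rwa [hk0])
  obtain ⟨r, hr, hd⟩ := Metric.eventually_nhds_iff_ball.1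
    (hm.eventually_analyticAt.mono fun _ h => h.differentiableAt)
  obtain ⟨P, hP⟩ := DifferentiableOn.isExactOn_ball (c := 0) (r := r)
    (f := fun x => -dslope k 0 x / k x) fun x hx => (hd x hx).differentiableWithinAt
  have hball : Metric.ball (0 : ℂ) r ∈ 𝓝 0 := Metric.ball_mem_nhds _ hr
  have hPa : AnalyticAt ℂ P 0 := Complex.analyticAt_iff_eventually_differentiableAt.2
    (Filter.mem_of_superset hball fun x hx => (hP x hx).differentiableAt)
  set ψ : ℂ → ℂ := fun x => x * Complex.exp (P x) with hψ
  have hψa : AnalyticAt ℂ ψ 0 := analyticAt_id.mul hPa.cexp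
  have hψd : ∀ x ∈ Metric.ball (0 : ℂ) r, HasDerivAt ψ
      (1 * Complex.exp (P x) + x * (Complex.exp (P x) * (-dslope k 0 x / k x))) x := fun x hx =>
    (hasDerivAt_id x).mul (hP x hx).cexp
  have hψg : ∀ᶠ x in 𝓝 0, deriv ψ x * g x = a * ψ x := by
    filter_upwards [hball, hka.continuousAt.eventually_ne (by rwa [hk0] : k 0 ≠ 0)] with x hx hkx
    rw [(hψd x hx).deriv, hgk, hψ]
    have := hkk x
    field_simp
    linear_combination -x * this
  have hψ0 : ψ 0 = 0 := by simp [hψ]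
  have hd0 : HasDerivAt ψ (Complex.exp (P 0)) 0 := by
    simpa using hψd 0 (Metric.mem_ball_self hr)
  obtain ⟨χ, h1, h2, h3, h4, -⟩ := hψa.holAt.exists_localInverse
    (ContinuousLinearEquiv.unitsEquivAut ℂ (Units.mk0 _ (Complex.exp_ne_zero (P 0))))
    (hd0.hasFDerivAt_equiv (Complex.exp_ne_zero (P 0)))
  rw [hψ0] at h1 h2 h4
  have hχa := h1.analyticAt
  refine ⟨ψ, χ, hψa, hχa, hψ0, h2, h3, h4, ?_⟩
  have hten : Tendsto χ (𝓝 0) (𝓝 0) := by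
    simpa [ContinuousAt, h2] using hχa.continuousAt
  filter_upwards [h4.eventually_nhds, hχa.eventually_analyticAt, hten.eventually hψg,
    hten.eventually hψa.eventually_analyticAt] with ζ h5 h6 h7 h8
  have h9 : HasDerivAt (fun ζ => ψ (χ ζ)) (deriv ψ (χ ζ) * deriv χ ζ) ζ :=
    h8.differentiableAt.hasDerivAt.comp ζ h6.differentiableAt.hasDerivAt
  have h10 : deriv ψ (χ ζ) * deriv χ ζ = 1 :=
    (h9.congr_of_eventuallyEq (f₁ := fun ζ => ζ) (h5.mono fun _ h => h.symm)).unique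
      (hasDerivAt_id ζ)
  have h11 := h5.self_of_nhds
  rw [h11] at h7
  calc g (χ ζ) = (deriv ψ (χ ζ) * deriv χ ζ) * g (χ ζ) := by rw [h10, one_mul]
    _ = deriv χ ζ * (a * ζ) := by rw [← h7]; ring

end Linearization

/-! ### Parametrization and tangency of locally invariant curves. -/

section Curves

/-- A holomorphic curve is locally parametrized by any linear functional that does not vanish on
its tangent. -/
theorem IsHolomorphicCurve.exists_param {v : Phase} {M : Set Phase} (hM : IsHolomorphicCurve v M)
    (l : Phase →L[ℂ] ℂ) (hl : l v = 1) :
    ∃ γ : ℂ → Phase, AnalyticAt ℂ γ 0 ∧ γ 0 = 0 ∧ deriv γ 0 = v ∧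
      (∀ᶠ x in 𝓝 0, l (γ x) = x) ∧ ∀ᶠ q in 𝓝 0, (q ∈ M ↔ q = γ (l q)) := by
  obtain ⟨N, h, hN, h0N, hd, rfl, h0M, -, hker⟩ := hM
  have hh0 : h 0 = 0 := h0M.2
  have hh : HolAt h 0 := Filter.mem_of_superset (hN.mem_nhds h0N) fun q hq =>
    hd.differentiableAt (hN.mem_nhds hq)
  have hΨ : HolAt (fun q => (l q, h q)) 0 := hh.mono fun q hq =>
    l.differentiableAt.prodMk hq
  have hΨ' : HasFDerivAt (fun q => (l q, h q)) (l.prod (fderiv ℂ h 0)) 0 :=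
    l.hasFDerivAt.prodMk hh.differentiableAt.hasFDerivAt
  -- The kernel of `Dh` is the line of `v`, on which `l` is injective. So `(l, h)` is a local chart,
  -- straightening the curve to the first axis.
  have hinj : Function.Injective (l.prod (fderiv ℂ h 0)).toLinearMap := by
    rw [← LinearMap.ker_eq_bot, LinearMap.ker_eq_bot']
    intro a ha
    have h1 : l a = 0 := congrArg Prod.fst ha
    have h2 : fderiv ℂ h 0 a = 0 := congrArg Prod.snd ha
    obtain ⟨c, rfl⟩ := Submodule.mem_span_singleton.1 ((hker a).1 h2)
    have : c = 0 := by simpa [hl] using h1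
    simp [this]
  let L : Phase ≃L[ℂ] Phase :=
    (LinearEquiv.ofInjectiveEndo (l.prod (fderiv ℂ h 0)).toLinearMap hinj).toContinuousLinearEquiv
  have hL : (L : Phase →L[ℂ] Phase) = l.prod (fderiv ℂ h 0) :=
    ContinuousLinearMap.ext fun _ => rfl
  obtain ⟨g, h1, h2, h3, h4, h5⟩ := hΨ.exists_localInverse L (by rw [hL]; exact hΨ')
  have hz : (l 0, h 0) = ((0 : ℂ), (0 : ℂ × ℂ)) := by rw [map_zero, hh0]
  simp only [hz] at h1 h2 h4 h5
  have hγ : HolAt (fun x : ℂ => g (x, 0)) 0 :=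
    HolAt.comp (g := g) (f := fun x : ℂ => (x, (0 : ℂ × ℂ))) h1
      (Differentiable.holAt (by fun_prop) _)
  have hLv : L.symm (1, 0) = v := by
    rw [ContinuousLinearEquiv.symm_apply_eq]
    have h6 : L v = (l v, fderiv ℂ h 0 v) := rfl
    rw [h6, hl, (hker v).2 (Submodule.mem_span_singleton_self v)]
  have hγd : HasDerivAt (fun x : ℂ => g (x, 0)) v 0 := by
    have h6 : HasDerivAt (fun x : ℂ => (x, (0 : ℂ × ℂ))) (1, 0) 0 :=
      (hasDerivAt_id _).prodMk (hasDerivAt_const _ _)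
    rw [← hLv]
    exact HasFDerivAt.comp_hasDerivAt (0 : ℂ) (f := fun x : ℂ => (x, (0 : ℂ × ℂ))) h5 h6
  have ht1 : Tendsto (fun x : ℂ => (x, (0 : ℂ × ℂ))) (𝓝 0) (𝓝 (0, 0)) :=
    Continuous.tendsto (by fun_prop) _
  have ht2 : Tendsto (fun q : Phase => (l q, (0 : ℂ × ℂ))) (𝓝 0) (𝓝 (0, 0)) := by
    have : Continuous (fun q : Phase => (l q, (0 : ℂ × ℂ))) := by fun_prop
    simpa using this.tendsto 0
  refine ⟨fun x => g (x, 0), hγ.analyticAt, h2, hγd.deriv, ?_, ?_⟩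
  · filter_upwards [ht1.eventually h4] with x hx
    exact congrArg Prod.fst hx
  · filter_upwards [hN.mem_nhds h0N, h3, ht2.eventually h4] with q hq hq3 hq4
    constructor
    · rintro ⟨-, hq0⟩
      rw [hq0] at hq3
      exact hq3.symm
    · intro hqe
      refine ⟨hq, ?_⟩
      rw [← hqe] at hq4
      exact congrArg Prod.snd hq4

/-- The vector field is tangent to a locally invariant curve. -/
theorem LocallyInvariant.tangent {F : Phase → Phase} (hF : HolAt F 0) {M : Set Phase}
    (hM : LocallyInvariant F M) {l : Phase →L[ℂ] ℂ} {γ : ℂ → Phase} (hγ : AnalyticAt ℂ γ 0)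
    (hγ0 : γ 0 = 0) (hl : ∀ᶠ x in 𝓝 0, l (γ x) = x)
    (hγM : ∀ᶠ q in 𝓝 0, (q ∈ M ↔ q = γ (l q))) :
    ∀ᶠ x in 𝓝 0, F (γ x) = l (F (γ x)) • deriv γ x := by
  obtain ⟨N, hN, hinv⟩ := hM
  have hten : Tendsto γ (𝓝 0) (𝓝 0) := by
    simpa [ContinuousAt, hγ0] using hγ.continuousAt
  have hNe : ∀ᶠ q in 𝓝 (0 : Phase), q ∈ N := hN
  filter_upwards [hten.eventually (hγM.and (hNe.and hF)).eventually_nhds, hl,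
    hγ.eventually_analyticAt] with x hgood hlx hγx
  set q := γ x with hq
  have hqM : q ∈ M := by
    rw [hgood.self_of_nhds.1, hlx]
  have hFq : HolAt F q := hgood.mono fun _ h => h.2.2
  -- The real-time solution through a point of the curve stays in it, so `α = γ ∘ l ∘ α`;
  -- differentiating at time `0` gives tangency.
  obtain ⟨r, hr, ε, hε, hsol⟩ := (hFq.contDiffAt.restrict_scalars
    ℝ).exists_forall_mem_closedBall_exists_eq_forall_mem_Ioo_hasDerivAt 0
  obtain ⟨α, hα0, hα⟩ := hsol q (Metric.mem_closedBall_self hr.le)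
  have hα00 := hα 0 (by simp [hε])
  rw [hα0] at hα00
  have hαc : Tendsto α (𝓝 0) (𝓝 q) := by
    simpa [ContinuousAt, hα0] using hα00.continuousAt
  obtain ⟨δ, hδ, hδg⟩ := Metric.eventually_nhds_iff_ball.1
    ((hαc.eventually hgood).and (Ioo_mem_nhds (sub_lt_self 0 hε) (lt_add_of_pos_right 0 hε)))
  have hIcc : ∀ t ∈ Set.Icc 0 (δ / 2), t ∈ Metric.ball (0 : ℝ) δ := fun t ht => by
    rw [mem_ball_zero_iff, Real.norm_of_nonneg ht.1]; linarith [ht.2]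
  have hαM := hinv α 0 (δ / 2) (fun t ht => ⟨(hδg t (hIcc t ht)).1.2.1,
    (hα t (hδg t (hIcc t ht)).2).hasDerivWithinAt⟩)
    ⟨0, ⟨le_rfl, by positivity⟩, by rwa [hα0]⟩
  have hαγ : ∀ t ∈ Set.Icc 0 (δ / 2), α t = γ (l (α t)) := fun t ht =>
    (hδg t (hIcc t ht)).1.1.1 (hαM t ht)
  have h0 : (0 : ℝ) ∈ Set.Icc 0 (δ / 2) := ⟨le_rfl, by positivity⟩
  have hlα : HasDerivAt (fun t => l (α t)) (l (F q)) 0 :=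
    (l.restrictScalars ℝ).hasFDerivAt.comp_hasDerivAt 0 hα00
  have hd2 : HasDerivAt (fun t => γ (l (α t))) (l (F q) • deriv γ x) 0 := by
    have h1 : HasDerivAt γ (deriv γ x) (l (α 0)) := by
      rw [hα0, hlx]; exact hγx.differentiableAt.hasDerivAt
    exact HasDerivAt.scomp (0 : ℝ) h1 hlα
  -- The identity is known only for `t ≥ 0`, so one-sided derivatives are compared.
  exact (uniqueDiffOn_Icc (by positivity : (0 : ℝ) < δ / 2)).uniqueDiffWithinAt h0 |>.eq_deriv _
    hα00.hasDerivWithinAt (hd2.hasDerivWithinAt.congr hαγ (hαγ 0 h0))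

/-- The tangent of a locally invariant holomorphic curve is an eigenvector of the linear part. -/
theorem LocallyInvariant.exists_eigenvalue {F : Phase → Phase} (hF : HolAt F 0) (hF0 : F 0 = 0)
    {v : Phase} (hv : v ≠ 0) {M : Set Phase} (hc : IsHolomorphicCurve v M)
    (hM : LocallyInvariant F M) : ∃ κ : ℂ, fderiv ℂ F 0 v = κ • v := by
  obtain ⟨l, hl⟩ := SeparatingDual.exists_eq_one (R := ℂ) hv
  obtain ⟨γ, h1, h2, h3, h4, h5⟩ := hc.exists_param l hl
  have h6 := hM.tangent hF h1 h2 h4 h5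
  have hd1 : HasDerivAt (fun x => F (γ x)) (fderiv ℂ F 0 v) 0 := by
    rw [← h3]
    refine HasFDerivAt.comp_hasDerivAt (0 : ℂ) ?_ h1.differentiableAt.hasDerivAt
    rw [h2]
    exact hF.differentiableAt.hasFDerivAt
  have hd2 : HasDerivAt (fun x => l (F (γ x))) (l (fderiv ℂ F 0 v)) 0 :=
    l.hasFDerivAt.comp_hasDerivAt 0 hd1
  have hd3 := hd2.fun_smul h1.deriv.differentiableAt.hasDerivAt
  have := hd1.unique (hd3.congr_of_eventuallyEq h6)
  refine ⟨l (fderiv ℂ F 0 v), ?_⟩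
  simpa [h2, hF0, h3] using this

end Curves

/-! ### Invariant graphs: local invariance and closed orbits. -/

section InvariantGraphs

/-- The graph of `R` is an invariant curve of the field `G`, tangent to the first axis. -/
structure InvCurve (G : Phase → Phase) (R : ℂ → ℂ × ℂ) : Prop where
  analytic : AnalyticAt ℂ R 0
  zero : R 0 = 0
  deriv_zero : deriv R 0 = 0
  equation : ∀ᶠ x in 𝓝 0, (G (x, R x)).2 = (G (x, R x)).1 • deriv R x

variable {G : Phase → Phase} {R : ℂ → ℂ × ℂ} {M : Set Phase}

theorem InvCurve.tendsto (hR : InvCurve G R) :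
    Tendsto (fun x : ℂ => (x, R x)) (𝓝 0) (𝓝 (0 : Phase)) := by
  have := hR.analytic.continuousAt
  have h : ContinuousAt (fun x : ℂ => (x, R x)) 0 := by fun_prop
  rw [ContinuousAt, hR.zero] at h
  exact h

theorem exists_invCurve (hG : HolAt G 0) (hc : IsHolomorphicCurve xAxis M)
    (hM : LocallyInvariant G M) :
    ∃ R, InvCurve G R ∧ ∀ᶠ q in 𝓝 0, (q ∈ M ↔ q.2 = R q.1) := by
  obtain ⟨γ, h1, h2, h3, h4, h5⟩ := hc.exists_param (ContinuousLinearMap.fst ℂ ℂ (ℂ × ℂ)) rfl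
  have h6 := hM.tangent hG h1 h2 h4 h5
  simp only [ContinuousLinearMap.coe_fst'] at h4 h5 h6
  have hd : ∀ x, AnalyticAt ℂ γ x → HasDerivAt (fun x => (γ x).2) (deriv γ x).2 x := fun x hx =>
    (hasFDerivAt_snd (𝕜 := ℂ) (E := ℂ) (F := ℂ × ℂ) (p := γ x)).comp_hasDerivAt x
      hx.differentiableAt.hasDerivAt
  have ht : Tendsto (fun q : Phase => q.1) (𝓝 0) (𝓝 0) := by
    simpa using (continuous_fst (X := ℂ) (Y := ℂ × ℂ)).tendsto 0
  refine ⟨fun x => (γ x).2, ⟨?_, by simp [h2], ?_, ?_⟩, ?_⟩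
  · exact (HolAt.analyticAt (h1.eventually_analyticAt.mono fun x hx => (hd x hx).differentiableAt))
  · rw [(hd 0 h1).deriv, h3]; rfl
  · filter_upwards [h4, h6, h1.eventually_analyticAt] with x hx hx6 hxa
    have h7 : (x, (γ x).2) = γ x := Prod.ext hx.symm rfl
    rw [h7, (hd x hxa).deriv]
    exact congrArg Prod.snd hx6
  · filter_upwards [h5, ht.eventually h4] with q hq hq4
    rw [hq]
    constructor
    · intro h; exact congrArg Prod.snd h
    · intro h; exact Prod.ext hq4.symm h

/-- Grönwall's inequality in both time directions, the past by time reversal: a solution arc may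
meet the invariant curve at any of its times. -/
theorem eq_zero_of_norm_derivWithin_le {E : Type*} [NormedAddCommGroup E] [NormedSpace ℝ E]
    {f f' : ℝ → E} {K a b : ℝ} (hf : ∀ t ∈ Set.Icc a b, HasDerivWithinAt f (f' t) (Set.Icc a b) t)
    (hK : ∀ t ∈ Set.Icc a b, ‖f' t‖ ≤ K * ‖f t‖) {c : ℝ} (hc : c ∈ Set.Icc a b) (hfc : f c = 0) :
    ∀ t ∈ Set.Icc a b, f t = 0 := by
  intro t ht
  rcases le_total c t with hct | hct
  · have hsub : Set.Icc c t ⊆ Set.Icc a b := Set.Icc_subset_Icc hc.1 ht.2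
    refine eq_zero_of_abs_deriv_le_mul_abs_self_of_eq_zero_right (f' := f') (K := K) (a := c)
      (b := t) (fun s hs => (hf s (hsub hs)).continuousWithinAt.mono hsub) (fun s hs => ?_) hfc
      (fun s hs => hK s (hsub ⟨hs.1, hs.2.le⟩)) t ⟨hct, le_rfl⟩
    refine ((hf s (hsub ⟨hs.1, hs.2.le⟩)).mono hsub).mono_of_mem_nhdsWithin ?_
    exact Icc_mem_nhdsGE_of_mem hs
  · have hsub : ∀ s ∈ Set.Icc (-c) (-t), -s ∈ Set.Icc a b := fun s hs =>
      ⟨by linarith [hs.2, ht.1], by linarith [hs.1, hc.2]⟩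
    have hd : ∀ s ∈ Set.Icc (-c) (-t), HasDerivWithinAt (fun s => f (-s)) (-f' (-s))
        (Set.Icc (-c) (-t)) s := by
      intro s hs
      have := HasDerivWithinAt.scomp (h := fun s : ℝ => -s) (h' := -1) (s := Set.Icc (-c) (-t)) s
        (hf (-s) (hsub s hs)) (hasDerivAt_neg s).hasDerivWithinAt hsub
      simpa [Function.comp_def] using this
    have := eq_zero_of_abs_deriv_le_mul_abs_self_of_eq_zero_right (f := fun s => f (-s))
      (f' := fun s => -f' (-s)) (K := K) (a := -c) (b := -t)
      (fun s hs => (hd s hs).continuousWithinAt) (fun s hs => ?_) (by simpa using hfc)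
      (fun s hs => by simpa using hK (-s) (hsub s ⟨hs.1, hs.2.le⟩)) (-t) ⟨by linarith, le_rfl⟩
    · simpa using this
    · exact (hd s ⟨hs.1, hs.2.le⟩).mono_of_mem_nhdsWithin (Icc_mem_nhdsGE_of_mem hs)

/-- The graph of an invariant curve is a locally invariant complex submanifold. -/
theorem InvCurve.exists_graph (hG : HolAt G 0) (hR : InvCurve G R) :
    ∃ M, IsHolomorphicCurve xAxis M ∧ LocallyInvariant G M ∧
      ∀ᶠ q in 𝓝 0, (q ∈ M ↔ q.2 = R q.1) := by
  obtain ⟨r, hr, hd⟩ := Metric.eventually_nhds_iff_ball.1 hR.analytic.eventually_analyticAt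
  set N : Set Phase := {q | q.1 ∈ Metric.ball (0 : ℂ) r} with hN
  have hNo : IsOpen N := Metric.isOpen_ball.preimage continuous_fst
  have h0N : (0 : Phase) ∈ N := Metric.mem_ball_self hr
  have hhd : ∀ q ∈ N, HasFDerivAt (fun q : Phase => q.2 - R q.1)
      (ContinuousLinearMap.snd ℂ ℂ (ℂ × ℂ) -
        (ContinuousLinearMap.fst ℂ ℂ (ℂ × ℂ)).smulRight (deriv R q.1)) q := by
    intro q hq
    refine hasFDerivAt_snd.sub ?_
    have h1 := (hd q.1 hq).differentiableAt.hasDerivAt.hasFDerivAt.comp q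
      (hasFDerivAt_fst (𝕜 := ℂ) (E := ℂ) (F := ℂ × ℂ) (p := q))
    exact h1.congr_fderiv (ContinuousLinearMap.ext fun _ => rfl)
  refine ⟨{q ∈ N | q.2 - R q.1 = 0}, ⟨N, fun q => q.2 - R q.1, hNo, h0N, fun q hq =>
    (hhd q hq).differentiableAt.differentiableWithinAt, rfl, ⟨h0N, by simp [hR.zero]⟩, ?_, ?_⟩,
    ?_, ?_⟩
  · intro q hq b
    rw [(hhd q hq.1).fderiv]
    exact ⟨(0, b), by simp⟩
  · intro p
    rw [(hhd 0 h0N).fderiv, Submodule.mem_span_singleton]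
    simp only [Prod.fst_zero, hR.deriv_zero, sub_apply, ContinuousLinearMap.coe_snd',
      ContinuousLinearMap.smulRight_apply, smul_zero, sub_zero]
    constructor
    · intro h
      refine ⟨p.1, Prod.ext (by simp [xAxis]) (by rw [h]; simp [xAxis])⟩
    · rintro ⟨c, rfl⟩
      simp [xAxis]
  -- This map is the time derivative of the defect `q.2 - R q.1` along orbits. It vanishes on the
  -- graph and is Lipschitz, hence is bounded by a multiple of the defect, and Grönwall applies.
  · have hk : HolAt (fun q : Phase => (G q).2 - (G q).1 • deriv R q.1) 0 := by
      have h1 : ∀ᶠ q : Phase in 𝓝 0, AnalyticAt ℂ R q.1 :=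
        Filter.mem_of_superset (hNo.mem_nhds h0N) fun q hq => hd q.1 hq
      filter_upwards [hG, h1] with q h2 h3
      have h4 : DifferentiableAt ℂ (fun q : Phase => deriv R q.1) q :=
        h3.deriv.differentiableAt.comp q differentiableAt_fst
      exact (differentiableAt_snd.comp q h2).sub ((differentiableAt_fst.comp q h2).smul h4)
    obtain ⟨K, s, hs, hlip⟩ := hk.hasStrictFDerivAt.exists_lipschitzOnWith
    have hπ : Tendsto (fun q : Phase => q.1) (𝓝 0) (𝓝 0) := by
      simpa using (continuous_fst (X := ℂ) (Y := ℂ × ℂ)).tendsto 0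
    have hgraph : Tendsto (fun q : Phase => (q.1, R q.1)) (𝓝 0) (𝓝 (0 : Phase)) :=
      hR.tendsto.comp hπ
    refine ⟨{q | q ∈ N ∧ q ∈ s ∧ (q.1, R q.1) ∈ s ∧
      (G (q.1, R q.1)).2 = (G (q.1, R q.1)).1 • deriv R q.1}, ?_, ?_⟩
    · filter_upwards [hNo.mem_nhds h0N, hs, hgraph hs, hπ.eventually hR.equation] with q h1 h2 h3 h4
      exact ⟨h1, h2, h3, h4⟩
    · rintro φ a b hφ ⟨c, hc, hcM⟩ t ht
      refine ⟨(hφ t ht).1.1, ?_⟩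
      refine eq_zero_of_norm_derivWithin_le (f := fun t => (φ t).2 - R (φ t).1)
        (f' := fun t => (G (φ t)).2 - (G (φ t)).1 • deriv R (φ t).1) (K := K) ?_ ?_ hc hcM.2 t ht
      · intro t ht
        have := ((hhd (φ t) (hφ t ht).1.1).restrictScalars ℝ).comp_hasDerivWithinAt t (hφ t ht).2
        exact this
      · intro t ht
        obtain ⟨⟨h1, h2, h3, h4⟩, -⟩ := hφ t ht
        have h5 := hlip.norm_sub_le h2 h3
        simp only [h4, sub_self, sub_zero] at h5
        refine h5.trans (le_of_eq ?_)
        congr 1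
        have h6 : φ t - ((φ t).1, R (φ t).1) = ((0 : ℂ), (φ t).2 - R (φ t).1) :=
          Prod.ext (sub_self _) rfl
        rw [h6, Prod.norm_mk, norm_zero, max_eq_right (norm_nonneg _)]
  · filter_upwards [hNo.mem_nhds h0N] with q hq
    simp only [hq, true_and, sub_eq_zero]

/-- An invariant curve on which the linear part is a rotation is filled with isochronous closed
orbits. -/
theorem InvCurve.isochronous (hG : HolAt G 0) (hG0 : G 0 = 0) (hR : InvCurve G R)
    {ω : ℝ} (hω : ω ≠ 0) (hx : (fderiv ℂ G 0 xAxis).1 = Complex.I * ω)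
    (hM : ∀ᶠ q in 𝓝 0, (q ∈ M ↔ q.2 = R q.1)) :
    HasIsochronousCenterFamily G M (2 * Real.pi / |ω|) := by
  have hgd : HasDerivAt (fun x => (G (x, R x)).1) (Complex.I * ω) 0 := by
    have h1 : HasDerivAt (fun x : ℂ => (x, R x)) xAxis 0 := by
      have := (hasDerivAt_id (0 : ℂ)).prodMk hR.analytic.differentiableAt.hasDerivAt
      rw [hR.deriv_zero] at this
      exact this
    have h2 : HasDerivAt (fun x : ℂ => G (x, R x)) (fderiv ℂ G 0 xAxis) 0 := by
      refine HasFDerivAt.comp_hasDerivAt (0 : ℂ) (f := fun x : ℂ => (x, R x)) ?_ h1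
      rw [hR.zero]
      exact hG.differentiableAt.hasFDerivAt
    rw [← hx]
    exact hasFDerivAt_fst.comp_hasDerivAt (0 : ℂ) h2
  have hRa := hR.analytic.eventually_analyticAt
  have hga : AnalyticAt ℂ (fun x => (G (x, R x)).1) 0 := by
    refine HolAt.analyticAt ?_
    filter_upwards [hR.tendsto.eventually hG, hRa] with x h1 h2
    have h3 : DifferentiableAt ℂ (fun x : ℂ => (x, R x)) x :=
      differentiableAt_id.prodMk h2.differentiableAt
    exact differentiableAt_fst.comp x (h1.comp x h3)
  have ha0 : Complex.I * (ω : ℂ) ≠ 0 := by simp [hω]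
  obtain ⟨ψ, χ, hψ, hχ, hψ0, hχ0, hχψ, hψχ, hlin⟩ := exists_linearization hga
    (by simp [hR.zero, show G ((0 : ℂ), (0 : ℂ × ℂ)) = 0 from hG0]) (by rw [hgd.deriv]; exact ha0)
  rw [hgd.deriv] at hlin
  intro V hV
  have hχt : Tendsto χ (𝓝 0) (𝓝 0) := by simpa [ContinuousAt, hχ0] using hχ.continuousAt
  have hψt : Tendsto ψ (𝓝 0) (𝓝 0) := by simpa [ContinuousAt, hψ0] using hψ.continuousAt
  have hVe : ∀ᶠ q in 𝓝 (0 : Phase), q ∈ V := hV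
  obtain ⟨ε, hε, hgood⟩ := Metric.eventually_nhds_iff_ball.1
    (((hχt.eventually hRa).and (hχt.eventually hR.equation)).and
    (((hR.tendsto.comp hχt).eventually (hM.and hVe)).and
      (hψχ.and (hlin.and hχ.eventually_analyticAt))))
  have hπ : Tendsto (fun q : Phase => q.1) (𝓝 0) (𝓝 0) := by
    simpa using (continuous_fst (X := ℂ) (Y := ℂ × ℂ)).tendsto 0
  have hWnh : ∀ᶠ q : Phase in 𝓝 0, (q ∈ M ↔ q.2 = R q.1) ∧ χ (ψ q.1) = q.1 ∧
      ψ q.1 ∈ Metric.ball (0 : ℂ) ε :=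
    hM.and ((hπ.eventually hχψ).and ((hψt.comp hπ).eventually (Metric.ball_mem_nhds _ hε)))
  refine ⟨_, hWnh, ?_⟩
  rintro p ⟨hpM, hp1, hp2, hp3⟩ hp0
  have hpR : p.2 = R p.1 := hp1.1 hpM
  set ζ := ψ p.1 with hζ
  have hζ0 : ζ ≠ 0 := by
    intro h
    rw [h, hχ0] at hp2
    apply hp0
    rw [← hp2, hR.zero] at hpR
    exact Prod.ext hp2.symm hpR
  -- In the linearizing coordinate the orbits are circles, so they never leave the disc and the
  -- solutions exist for all times.
  have hrot : ∀ t : ℝ, Complex.exp (Complex.I * ω * t) * ζ ∈ Metric.ball (0 : ℂ) ε := by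
    intro t
    have : ‖Complex.exp (Complex.I * ω * t)‖ = 1 := by
      rw [Complex.norm_exp]; simp
    rw [mem_ball_zero_iff, norm_mul, this, one_mul]
    exact mem_ball_zero_iff.1 hp3
  set x : ℝ → ℂ := fun t => χ (Complex.exp (Complex.I * ω * t) * ζ) with hxdef
  have hx0 : x 0 = p.1 := by simp [hxdef, hp2]
  have hpe : (p.1, R p.1) = p := Prod.ext rfl hpR.symm
  refine ⟨fun t => (x t, R (x t)), ?_, ?_, ?_, ?_, ?_⟩
  · simp only [hx0, hpe]
  · intro t
    obtain ⟨⟨h1, h2⟩, -, -, h3, h4⟩ := hgood _ (hrot t)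
    have hd1 : HasDerivAt (fun t : ℝ => Complex.exp (Complex.I * ω * t) * ζ)
        (Complex.I * ω * (Complex.exp (Complex.I * ω * t) * ζ)) t := by
      have h5 : HasDerivAt (fun t : ℝ => Complex.I * ω * (t : ℂ)) (Complex.I * ω) t := by
        simpa using (Complex.ofRealCLM.hasDerivAt (x := t)).const_mul (Complex.I * (ω : ℂ))
      exact (h5.cexp.mul_const ζ).congr_deriv (by ring)
    have hd2 : HasDerivAt x (G (x t, R (x t))).1 t := by
      have h6 := HasDerivAt.scomp t h4.differentiableAt.hasDerivAt hd1
      rw [h3]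
      exact h6.congr_deriv (mul_comm _ _)
    have hd3 : HasDerivAt (fun t => R (x t)) (G (x t, R (x t))).2 t := by
      rw [h2]
      exact HasDerivAt.scomp t h1.differentiableAt.hasDerivAt hd2
    exact hd2.prodMk hd3
  · intro t
    obtain ⟨-, ⟨h1, h2⟩, -⟩ := hgood _ (hrot t)
    exact ⟨h1.2 rfl, h2⟩
  · intro t
    have h1 : Complex.exp (Complex.I * ω * ((t + 2 * Real.pi / |ω| : ℝ) : ℂ)) =
        Complex.exp (Complex.I * ω * t) := by
      rcases abs_cases ω with ⟨h, -⟩ | ⟨h, -⟩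
      · have h2 : Complex.I * ω * ((t + 2 * Real.pi / |ω| : ℝ) : ℂ) =
            Complex.I * ω * t + 2 * Real.pi * Complex.I := by
          rw [h]; push_cast
          have : (ω : ℂ) ≠ 0 := by exact_mod_cast hω
          field_simp
        rw [h2, Complex.exp_periodic]
      · have h2 : Complex.I * ω * ((t + 2 * Real.pi / |ω| : ℝ) : ℂ) =
            Complex.I * ω * t - 2 * Real.pi * Complex.I := by
          rw [h]; push_cast
          have : (ω : ℂ) ≠ 0 := by exact_mod_cast hω
          field_simp
          ring
        rw [h2, Complex.exp_periodic.sub_eq]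
    simp only [hxdef, h1]
  · intro s hs hsp
    have h1 : x s = p.1 := congrArg Prod.fst hsp
    have h2 := (hgood _ (hrot s)).2.2.1
    have h3 : Complex.exp (Complex.I * ω * s) * ζ = ζ := by
      rw [← h2]
      exact congrArg ψ h1
    -- A return at time `s` makes `ω s` a multiple `2π n`; since `0 < s < 2π / |ω|`, this forces `n
    -- = 0` and a contradiction.
    have h4 : Complex.exp (Complex.I * ω * s) = 1 := by
      simpa [hζ0] using h3
    obtain ⟨n, hn⟩ := Complex.exp_eq_one_iff.1 h4
    have h5 : ω * s = n * (2 * Real.pi) := by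
      have : Complex.I * ((ω * s : ℝ) : ℂ) = Complex.I * ((n * (2 * Real.pi) : ℝ) : ℂ) := by
        push_cast; linear_combination hn
      exact_mod_cast mul_left_cancel₀ Complex.I_ne_zero this
    have habs : 0 < |ω| := abs_pos.2 hω
    have h6 : |ω| * s < 2 * Real.pi := by
      have := (lt_div_iff₀ habs).1 hs.2
      linarith
    have h7 : |ω| * s = |(n : ℝ)| * (2 * Real.pi) := by
      have := congrArg abs h5
      rwa [abs_mul, abs_mul, abs_of_pos hs.1, abs_of_pos Real.two_pi_pos] at this
    have h8 : |(n : ℝ)| < 1 := by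
      rw [h7] at h6
      by_contra h
      nlinarith [Real.two_pi_pos]
    have h9 : n = 0 := by
      have : |n| < 1 := by exact_mod_cast h8
      exact Int.abs_lt_one_iff.1 this
    rw [h9] at h7
    simp at h7
    rcases h7 with h7 | h7
    · exact hω h7
    · exact hs.1.ne' h7

end InvariantGraphs

/-! ### Invariance of the notions under linear coordinate changes. -/

section LinearChange

/-- The field `F` in the linear coordinates given by `L`. -/
noncomputable def linConj (F : Phase → Phase) (L : Phase ≃L[ℂ] Phase) : Phase → Phase := fun p =>
  L.symm (F (L p))

variable {F : Phase → Phase} (L : Phase ≃L[ℂ] Phase) {M : Set Phase} {v : Phase}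

theorem tendsto_linearEquiv_zero : Tendsto L (𝓝 0) (𝓝 0) := by
  simpa using L.continuous.tendsto 0

theorem linConj_symm : linConj (linConj F L) L.symm = F := by
  ext1 p; simp [linConj]

theorem preimage_preimage_symm : L.symm ⁻¹' (L ⁻¹' M) = M := by
  ext p; simp

theorem HolAt.linConj (hF : HolAt F 0) : HolAt (linConj F L) 0 := by
  filter_upwards [(tendsto_linearEquiv_zero L).eventually hF] with q hq
  exact L.symm.differentiableAt.comp q (hq.comp q L.differentiableAt)

theorem fderiv_linConj (hF : HolAt F 0) (a : Phase) :
    fderiv ℂ (_root_.linConj F L) 0 a = L.symm (fderiv ℂ F 0 (L a)) := by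
  have h1 : HasFDerivAt F (fderiv ℂ F 0) (L 0) := by
    rw [map_zero]; exact hF.differentiableAt.hasFDerivAt
  have h2 := (L.symm : Phase →L[ℂ] Phase).hasFDerivAt.comp (0 : Phase)
    (h1.comp (0 : Phase) (L : Phase →L[ℂ] Phase).hasFDerivAt)
  have h3 : HasFDerivAt (_root_.linConj F L) _ 0 := h2
  rw [h3.fderiv]
  rfl

theorem IsHolomorphicCurve.preimage (hM : IsHolomorphicCurve v M) :
    IsHolomorphicCurve (L.symm v) (L ⁻¹' M) := by
  obtain ⟨N, h, hN, h0N, hd, rfl, h0M, hsurj, hker⟩ := hM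
  have hder : ∀ q, L q ∈ N → fderiv ℂ (fun q => h (L q)) q =
      (fderiv ℂ h (L q)).comp (L : Phase →L[ℂ] Phase) := fun q hq =>
    ((hd.differentiableAt (hN.mem_nhds hq)).hasFDerivAt.comp q L.hasFDerivAt).fderiv
  refine ⟨L ⁻¹' N, fun q => h (L q), hN.preimage L.continuous, by simpa using h0N, ?_, rfl,
    by simpa using h0M, ?_, ?_⟩
  · exact hd.comp L.differentiable.differentiableOn fun q hq => hq
  · intro q hq
    rw [hder q hq.1]
    exact (hsurj (L q) hq).comp L.surjective
  · intro a
    rw [hder 0 (by simpa using h0N)]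
    simp only [map_zero, ContinuousLinearMap.comp_apply, ContinuousLinearEquiv.coe_coe, hker,
      Submodule.mem_span_singleton]
    constructor
    · rintro ⟨c, hc⟩
      exact ⟨c, by rw [← map_smul, hc]; simp⟩
    · rintro ⟨c, rfl⟩
      exact ⟨c, by simp⟩

theorem LocallyInvariant.preimage (hM : LocallyInvariant F M) :
    LocallyInvariant (linConj F L) (L ⁻¹' M) := by
  obtain ⟨N, hN, hinv⟩ := hM
  refine ⟨L ⁻¹' N, tendsto_linearEquiv_zero L hN, fun φ a b hφ ht => ?_⟩
  refine hinv (fun t => L (φ t)) a b (fun t ht => ⟨(hφ t ht).1, ?_⟩) ht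
  have h1 : HasFDerivAt L ((L : Phase →L[ℂ] Phase).restrictScalars ℝ) (φ t) :=
    ((L : Phase →L[ℂ] Phase).restrictScalars ℝ).hasFDerivAt
  have := h1.comp_hasDerivWithinAt t (hφ t ht).2
  simpa [linConj, Function.comp_def] using this

theorem HasIsochronousCenterFamily.preimage {T : ℝ} (hM : HasIsochronousCenterFamily F M T) :
    HasIsochronousCenterFamily (linConj F L) (L ⁻¹' M) T := by
  intro V hV
  obtain ⟨W, hW, h⟩ := hM (L.symm ⁻¹' V) (tendsto_linearEquiv_zero L.symm hV)
  refine ⟨L ⁻¹' W, tendsto_linearEquiv_zero L hW, fun p hp hp0 => ?_⟩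
  obtain ⟨φ, h1, h2, h3, h4, h5⟩ := h (L p) hp (by simpa using hp0)
  refine ⟨fun t => L.symm (φ t), by simp [h1], fun t => ?_, fun t => ⟨by simpa using (h3 t).1,
    (h3 t).2⟩, fun t => by simp [h4 t], fun s hs hsp => h5 s hs ?_⟩
  · have h6 : HasFDerivAt L.symm ((L.symm : Phase →L[ℂ] Phase).restrictScalars ℝ) (φ t) :=
      ((L.symm : Phase →L[ℂ] Phase).restrictScalars ℝ).hasFDerivAt
    have := h6.comp_hasDerivAt t (h2 t)
    simpa [linConj, Function.comp_def] using this
  · rw [← hsp]; simp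

theorem eventuallyEq_of_preimage {M' : Set Phase} (h : (L ⁻¹' M) =ᶠ[𝓝 0] (L ⁻¹' M' : Set Phase)) :
    M =ᶠ[𝓝 0] M' := by
  have := (tendsto_linearEquiv_zero L.symm).eventually h.mem_iff
  refine eventuallyEq_set.2 (this.mono fun q hq => ?_)
  simpa using hq

end LinearChange

/-! ### Diagonal Briot-Bouquet systems and the resonance. -/

section DiagonalSystems

/-- The diagonal operator with entries `q, s`. -/
noncomputable def diagCLM (q s : ℂ) : ℂ × ℂ →L[ℂ] ℂ × ℂ :=
  (q • ContinuousLinearMap.fst ℂ ℂ ℂ).prod (s • ContinuousLinearMap.snd ℂ ℂ ℂ)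

@[simp] theorem diagCLM_apply (q s : ℂ) (u : ℂ × ℂ) : diagCLM q s u = (q * u.1, s * u.2) := rfl

theorem diagCLM_sub_id (q s : ℂ) :
    diagCLM q s - ContinuousLinearMap.id ℂ (ℂ × ℂ) = diagCLM (q - 1) (s - 1) := by
  refine ContinuousLinearMap.ext fun u => Prod.ext ?_ ?_ <;> simp [sub_mul]

theorem diagCLM_sub_surjective {q s k : ℂ} (hq : q ≠ k) (hs : s ≠ k) (v : ℂ × ℂ) :
    ∃ u, diagCLM q s u - k • u = v := by
  have h1 := sub_ne_zero.2 hq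
  have h2 := sub_ne_zero.2 hs
  refine ⟨(v.1 / (q - k), v.2 / (s - k)), Prod.ext ?_ ?_⟩
  · simp only [diagCLM_apply, Prod.smul_mk, Prod.mk_sub_mk, smul_eq_mul]
    field_simp
  · simp only [diagCLM_apply, Prod.smul_mk, Prod.mk_sub_mk, smul_eq_mul]
    field_simp

theorem eq_zero_of_diagCLM_eq {q s k : ℂ} (hq : q ≠ k) (hs : s ≠ k) {u : ℂ × ℂ}
    (h : diagCLM q s u = k • u) : u = 0 := by
  have h1 := congrArg Prod.fst h
  have h2 := congrArg Prod.snd h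
  simp only [diagCLM_apply, Prod.smul_fst, Prod.smul_snd, smul_eq_mul, mul_eq_mul_right_iff, hq,
    hs, false_or] at h1 h2
  exact Prod.ext h1 h2

/-- A system `B x u v` as a map of the product. -/
def bbFun (B : BBSystem) : ℂ × (ℂ × ℂ) → ℂ × ℂ := fun p => B p.1 p.2.1 p.2.2

variable {B : BBSystem} {q s : ℂ}

theorem bbFun_bbStep : bbFun (bbStep B) =
    bbShift (bbFun B) (coeffP B / (1 - coeffQ B), coeffR B / (1 - coeffS B)) := rfl

theorem hasDerivAt_bbFun_first (hB : DifferentiableAt ℂ (bbFun B) 0) :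
    HasDerivAt (fun x => B x 0 0) (fderiv ℂ (bbFun B) 0 (1, 0)) 0 := by
  have h1 : HasDerivAt (fun x : ℂ => (x, (0 : ℂ × ℂ))) (1, 0) 0 :=
    (hasDerivAt_id _).prodMk (hasDerivAt_const _ _)
  exact HasFDerivAt.comp_hasDerivAt (0 : ℂ) (f := fun x : ℂ => (x, (0 : ℂ × ℂ)))
    hB.hasFDerivAt h1

theorem BBForm.fderiv_eq_coeff {A : ℂ × ℂ →L[ℂ] ℂ × ℂ} (hB : BBForm (bbFun B) A) :
    fderiv ℂ (bbFun B) 0 (1, 0) = (coeffP B, coeffR B) := by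
  have h := hasDerivAt_bbFun_first hB.hol.differentiableAt
  have h1 := HasFDerivAt.comp_hasDerivAt (0 : ℂ) (f := fun x => B x 0 0)
    (hasFDerivAt_fst (𝕜 := ℂ)) h
  have h2 := HasFDerivAt.comp_hasDerivAt (0 : ℂ) (f := fun x => B x 0 0)
    (hasFDerivAt_snd (𝕜 := ℂ)) h
  exact Prod.ext h1.deriv.symm h2.deriv.symm

theorem BBForm.coeffQ_eq (hB : BBForm (bbFun B) (diagCLM q s)) : coeffQ B = q := by
  have ht : Tendsto (fun u : ℂ => (u, (0 : ℂ))) (𝓝 0) (𝓝 0) :=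
    Continuous.tendsto (f := fun u : ℂ => (u, (0 : ℂ))) (by fun_prop) 0
  have h1 : (fun u => (B 0 u 0).1) =ᶠ[𝓝 0] fun u => q * u :=
    (ht.eventually hB.lin).mono fun u hu => congrArg Prod.fst hu
  rw [coeffQ, h1.deriv_eq]
  simp

theorem BBForm.coeffS_eq (hB : BBForm (bbFun B) (diagCLM q s)) : coeffS B = s := by
  have ht : Tendsto (fun v : ℂ => ((0 : ℂ), v)) (𝓝 0) (𝓝 0) :=
    Continuous.tendsto (f := fun v : ℂ => ((0 : ℂ), v)) (by fun_prop) 0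
  have h1 : (fun v => (B 0 0 v).2) =ᶠ[𝓝 0] fun v => s * v :=
    (ht.eventually hB.lin).mono fun u hu => congrArg Prod.snd hu
  rw [coeffS, h1.deriv_eq]
  simp

/-- The coefficient equations are kept undivided so that they also cover `q = 1`, where `e.1` is
free if `coeffP B = 0`. -/
theorem BBForm.shift_diag (hB : BBForm (bbFun B) (diagCLM q s)) {e : ℂ × ℂ}
    (h1 : coeffP B + (q - 1) * e.1 = 0) (h2 : coeffR B + (s - 1) * e.2 = 0) :
    BBForm (bbShift (bbFun B) e) (diagCLM (q - 1) (s - 1)) := by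
  rw [← diagCLM_sub_id]
  refine hB.shift ?_
  rw [hB.fderiv_eq_coeff]
  refine Prod.ext ?_ ?_
  · simp only [diagCLM_apply, Prod.fst_sub, Prod.fst_add, Prod.fst_zero]
    linear_combination h1
  · simp only [diagCLM_apply, Prod.snd_sub, Prod.snd_add, Prod.snd_zero]
    linear_combination h2

theorem BBForm.step (hB : BBForm (bbFun B) (diagCLM q s)) (hq : q ≠ 1) (hs : s ≠ 1) :
    BBForm (bbFun (bbStep B)) (diagCLM (q - 1) (s - 1)) := by
  have h1 := sub_ne_zero.2 hq.symm
  have h2 := sub_ne_zero.2 hs.symm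
  rw [bbFun_bbStep, hB.coeffQ_eq, hB.coeffS_eq]
  refine hB.shift_diag ?_ ?_
  · field_simp; ring
  · field_simp; ring

/-- Away from the resonance the coefficient equation determines `U' 0`, which is the shift vector of
`bbStep`; hence no solution is lost in a step. -/
theorem IsBBSol.step {U : ℂ → ℂ × ℂ} (hB : BBForm (bbFun B) (diagCLM q s)) (hq : q ≠ 1)
    (hs : s ≠ 1) (hU : IsBBSol (bbFun B) U) : ∃ V, IsBBSol (bbFun (bbStep B)) V := by
  have h1 := sub_ne_zero.2 hq.symm
  have h2 := sub_ne_zero.2 hs.symm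
  have h3 := hU.coeff hB
  rw [hB.fderiv_eq_coeff] at h3
  have h4 := congrArg Prod.fst h3
  have h5 := congrArg Prod.snd h3
  simp only [diagCLM_apply, Prod.fst_sub, Prod.fst_add, Prod.fst_zero, Prod.snd_sub, Prod.snd_add,
    Prod.snd_zero] at h4 h5
  refine ⟨fun x => dslope U 0 x - deriv U 0, ?_⟩
  rw [bbFun_bbStep, hB.coeffQ_eq, hB.coeffS_eq]
  have h6 : (coeffP B / (1 - q), coeffR B / (1 - s)) = deriv U 0 := by
    refine Prod.ext ?_ ?_
    · simp only
      rw [div_eq_iff h1]; linear_combination h4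
    · simp only
      rw [div_eq_iff h2]; linear_combination h5
  rw [h6]
  exact hU.to_shift hB

/-- A sequence of solutions with pairwise different germs. -/
def HasManySols (f : ℂ × (ℂ × ℂ) → ℂ × ℂ) : Prop :=
  ∃ 𝒰 : ℕ → ℂ → ℂ × ℂ, (∀ k, IsBBSol f (𝒰 k)) ∧ Pairwise fun k l => ¬ (𝒰 k =ᶠ[𝓝 0] 𝒰 l)

theorem HasManySols.of_step (hB : BBForm (bbFun B) (diagCLM q s))
    (h : HasManySols (bbFun (bbStep B))) : HasManySols (bbFun B) := by
  rw [bbFun_bbStep] at h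
  generalize (coeffP B / (1 - coeffQ B), coeffR B / (1 - coeffS B)) = e at h
  obtain ⟨𝒱, h1, h2⟩ := h
  refine ⟨_, fun k => (h1 k).of_shift hB, fun k l hkl hE => h2 hkl ?_⟩
  filter_upwards [hE] with x hx
  rcases eq_or_ne x 0 with rfl | hx0
  · rw [(h1 k).zero, (h1 l).zero]
  · exact add_right_cancel (smul_right_injective _ hx0 hx)

theorem BBForm.iterate_step (k : ℕ) {B : BBSystem} {q s : ℂ}
    (hB : BBForm (bbFun B) (diagCLM q s))
    (hq : ∀ j < k, q ≠ j + 1) (hs : ∀ j < k, s ≠ j + 1) :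
    BBForm (bbFun (bbStep^[k] B)) (diagCLM (q - k) (s - k)) ∧
      ((∃ U, IsBBSol (bbFun B) U) → ∃ V, IsBBSol (bbFun (bbStep^[k] B)) V) ∧
      (HasManySols (bbFun (bbStep^[k] B)) → HasManySols (bbFun B)) := by
  induction k generalizing B q s with
  | zero => simpa using hB
  | succ k ih =>
    have hq1 : q ≠ 1 := by simpa using hq 0 (by omega)
    have hs1 : s ≠ 1 := by simpa using hs 0 (by omega)
    obtain ⟨h1, h2, h3⟩ := ih (hB.step hq1 hs1)
      (fun j hj h => hq (j + 1) (by omega) (by push_cast; linear_combination h))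
      (fun j hj h => hs (j + 1) (by omega) (by push_cast; linear_combination h))
    rw [Function.iterate_succ_apply]
    refine ⟨?_, fun ⟨U, hU⟩ => h2 (hU.step hB hq1 hs1), fun h => (h3 h).of_step hB⟩
    convert h1 using 2 <;> push_cast <;> ring

/-- At the resonance `q = 1` solvability forces the coefficient of `x` to vanish. -/
theorem IsBBSol.coeffP_eq_zero {U : ℂ → ℂ × ℂ} (hB : BBForm (bbFun B) (diagCLM 1 s))
    (hU : IsBBSol (bbFun B) U) : coeffP B = 0 := by
  have h3 := hU.coeff hB
  rw [hB.fderiv_eq_coeff] at h3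
  simpa using congrArg Prod.fst h3

/-- At the resonance `q = 1` with vanishing coefficient of `x` there are infinitely many
solutions. -/
theorem BBForm.hasManySols (hB : BBForm (bbFun B) (diagCLM 1 s)) (hp : coeffP B = 0)
    (hs : ∀ k : ℕ, s ≠ k + 1) : HasManySols (bbFun B) := by
  have hs1 : s - 1 ≠ 0 := sub_ne_zero.2 (by simpa using hs 0)
  -- Any first component is an admissible slope; natural numbers suffice. The shifted entries are
  -- `0` and `s - 1`, so the Briot-Bouquet theorem applies, and the slopes at `0` distinguish the
  -- solutions.
  have hex : ∀ k : ℕ, ∃ U, IsBBSol (bbShift (bbFun B) ((k : ℂ), coeffR B / (1 - s))) U := by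
    intro k
    refine (hB.shift_diag (by simp [hp]) ?_).exists_sol fun j hj v => ?_
    · have := sub_ne_zero.2 (sub_ne_zero.1 hs1).symm
      field_simp; ring
    · refine diagCLM_sub_surjective ?_ ?_ v
      · rw [sub_self]
        exact_mod_cast (by omega : 0 ≠ j)
      · intro h
        exact hs j (by linear_combination h)
  choose 𝒱 h𝒱 using hex
  refine ⟨_, fun k => (h𝒱 k).of_shift hB, fun k l hkl hE => hkl ?_⟩
  have hd : ∀ k : ℕ, deriv (fun x : ℂ => x • (𝒱 k x + ((k : ℂ), coeffR B / (1 - s)))) 0 =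
      ((k : ℂ), coeffR B / (1 - s)) := by
    intro k
    have h1 := (hasDerivAt_id (0 : ℂ)).fun_smul
      ((h𝒱 k).analytic.differentiableAt.hasDerivAt.add_const ((k : ℂ), coeffR B / (1 - s)))
    refine h1.deriv.trans ?_
    simp [(h𝒱 k).zero]
  have h2 := hE.deriv_eq
  rw [hd, hd] at h2
  exact Nat.cast_injective (congrArg Prod.fst h2)

end DiagonalSystems

/-! ### From invariant curves to Briot-Bouquet systems and back. -/

section DiagonalFields

/-- A holomorphic field whose linear part at the equilibrium `0` is diagonal with entries
`a, b, c`, where `a ≠ 0`. -/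
structure DiagField (G : Phase → Phase) (a b c : ℂ) : Prop where
  hol : HolAt G 0
  zero : G 0 = 0
  fderiv_apply : ∀ p, fderiv ℂ G 0 p = (a * p.1, b * p.2.1, c * p.2.2)
  ne_zero : a ≠ 0

/-- The field at `(x, x e)` divided by `x`. -/
noncomputable def slopeField (G : Phase → Phase) : ℂ × (ℂ × ℂ) → Phase := fun p =>
  dslope (fun t => G (t, t • p.2)) 0 p.1

theorem bbFun_briotBouquet (G : Phase → Phase) (p : ℂ × (ℂ × ℂ)) :
    bbFun (briotBouquet G) p = (slopeField G p).1⁻¹ • (slopeField G p).2 - p.2 := by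
  refine Prod.ext ?_ ?_ <;>
  · simp only [Prod.fst_sub, Prod.snd_sub, Prod.smul_fst, Prod.smul_snd, smul_eq_mul,
      ← div_eq_inv_mul]
    rfl

variable {G : Phase → Phase} {a b c : ℂ} {R : ℂ → ℂ × ℂ}

theorem DiagField.holAt_slopeField (hG : DiagField G a b c) : HolAt (slopeField G) 0 := by
  have h1 : HolAt (fun p : ℂ × (ℂ × ℂ) => G (p.1, p.1 • p.2)) (0, 0) := by
    refine HolAt.comp (g := G) (f := fun p : ℂ × (ℂ × ℂ) => (p.1, p.1 • p.2)) ?_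
      (Differentiable.holAt (by fun_prop) _)
    simp only [smul_zero]
    exact hG.hol
  exact h1.dslope

theorem DiagField.slopeField_zero (hG : DiagField G a b c) (e : ℂ × ℂ) :
    slopeField G (0, e) = (a, b * e.1, c * e.2) := by
  have h1 : HasDerivAt (fun t : ℂ => (t, t • e)) (1, e) 0 := by
    simpa using (hasDerivAt_id (0 : ℂ)).prodMk ((hasDerivAt_id (0 : ℂ)).smul_const e)
  have h2 : HasDerivAt (fun t : ℂ => G (t, t • e)) (fderiv ℂ G 0 (1, e)) 0 := by
    refine HasFDerivAt.comp_hasDerivAt (0 : ℂ) (f := fun t : ℂ => (t, t • e)) ?_ h1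
    simp only [zero_smul]
    exact hG.hol.differentiableAt.hasFDerivAt
  rw [slopeField, dslope_same, h2.deriv, hG.fderiv_apply]
  simp

theorem DiagField.smul_slopeField (hG : DiagField G a b c) (x : ℂ) (e : ℂ × ℂ) :
    x • slopeField G (x, e) = G (x, x • e) := by
  have h := sub_smul_dslope (fun t => G (t, t • e)) 0 x
  have h3 : G ((0 : ℂ), (0 : ℂ × ℂ)) = 0 := hG.zero
  simpa [h3, slopeField] using h

theorem DiagField.eventually_slopeField_ne (hG : DiagField G a b c) :
    ∀ᶠ p in 𝓝 0, (slopeField G p).1 ≠ 0 := by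
  have h1 : (slopeField G 0).1 ≠ 0 := by
    have : slopeField G 0 = _ := hG.slopeField_zero 0
    rw [this]
    exact hG.ne_zero
  exact (continuous_fst.continuousAt.comp
    hG.holAt_slopeField.differentiableAt.continuousAt).eventually_ne h1

/-- At `x = 0` the divided field is `(a, b e.1, c e.2)`; its first component is constant, so the
quotient is exactly linear in `e`. -/
theorem DiagField.bbForm (hG : DiagField G a b c) :
    BBForm (bbFun (briotBouquet G)) (diagCLM (b / a - 1) (c / a - 1)) where
  hol := by
    have h : HolAt (fun p => (slopeField G p).1⁻¹ • (slopeField G p).2 - p.2) 0 := by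
      filter_upwards [hG.holAt_slopeField, hG.eventually_slopeField_ne] with p h1 h2
      have h3 : DifferentiableAt ℂ (fun p => (slopeField G p).1) p :=
        differentiableAt_fst.comp p h1
      have h4 : DifferentiableAt ℂ (fun p => (slopeField G p).2) p :=
        differentiableAt_snd.comp p h1
      exact ((h3.inv h2).smul h4).sub differentiableAt_snd
    exact h.congr (Eventually.of_forall (bbFun_briotBouquet G))
  lin := by
    refine Eventually.of_forall fun e => ?_
    have := hG.ne_zero
    rw [bbFun_briotBouquet, hG.slopeField_zero]
    refine Prod.ext ?_ ?_
    · simp; field_simp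
    · simp; field_simp

theorem InvCurve.of_isBBSol (hG : DiagField G a b c) {U : ℂ → ℂ × ℂ}
    (hU : IsBBSol (bbFun (briotBouquet G)) U) : InvCurve G fun x => x • U x := by
  have hd : ∀ x, AnalyticAt ℂ U x →
      HasDerivAt (fun x => x • U x) (x • deriv U x + (1 : ℂ) • U x) x := fun x hx =>
    (hasDerivAt_id x).fun_smul hx.differentiableAt.hasDerivAt
  have ht : Tendsto (fun x => (x, U x)) (𝓝 0) (𝓝 (0 : ℂ × (ℂ × ℂ))) := by
    have := hU.analytic.continuousAt
    have h : ContinuousAt (fun x : ℂ => (x, U x)) 0 := by fun_prop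
    rw [ContinuousAt, hU.zero] at h
    exact h
  refine ⟨analyticAt_id.smul hU.analytic, by simp, by simp [(hd 0 hU.analytic).deriv, hU.zero], ?_⟩
  filter_upwards [hU.equation, hU.analytic.eventually_analyticAt,
    ht.eventually hG.eventually_slopeField_ne] with x h1 h2 h3
  rw [(hd x h2).deriv, h1, ← hG.smul_slopeField, bbFun_briotBouquet, one_smul, sub_add_cancel,
    Prod.smul_fst, Prod.smul_snd, smul_eq_mul, mul_smul, smul_inv_smul₀ h3]

theorem InvCurve.eq_smul_dslope (hR : InvCurve G R) (x : ℂ) : R x = x • dslope R 0 x := by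
  simpa [hR.zero] using (sub_smul_dslope R 0 x).symm

theorem InvCurve.isBBSol (hG : DiagField G a b c) (hR : InvCurve G R) :
    IsBBSol (bbFun (briotBouquet G)) (dslope R 0) := by
  have hD : AnalyticAt ℂ (dslope R 0) 0 := by
    obtain ⟨p, hp⟩ := hR.analytic
    exact hp.has_fpower_series_dslope_fslope.analyticAt
  have hD0 : dslope R 0 0 = 0 := by rw [dslope_same, hR.deriv_zero]
  have ht : Tendsto (fun x => (x, dslope R 0 x)) (𝓝 0) (𝓝 (0 : ℂ × (ℂ × ℂ))) := by
    have := hD.continuousAt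
    have h : ContinuousAt (fun x : ℂ => (x, dslope R 0 x)) 0 := by fun_prop
    rw [ContinuousAt, hD0] at h
    exact h
  refine ⟨hD, hD0, ?_⟩
  filter_upwards [hR.equation, hD.eventually_analyticAt,
    ht.eventually hG.eventually_slopeField_ne] with x h1 h2 h3
  rcases eq_or_ne x 0 with rfl | hx0
  · rw [hD0, zero_smul]
    exact hG.bbForm.map_zero.symm
  · have hd : HasDerivAt R (x • deriv (dslope R 0) x + (1 : ℂ) • dslope R 0 x) x :=
      ((hasDerivAt_id x).fun_smul h2.differentiableAt.hasDerivAt).congr_of_eventuallyEq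
        (Eventually.of_forall hR.eq_smul_dslope)
    rw [hd.deriv, hR.eq_smul_dslope x, ← hG.smul_slopeField, Prod.smul_fst, Prod.smul_snd,
      smul_eq_mul, mul_smul] at h1
    have h4 := smul_right_injective _ hx0 h1
    rw [bbFun_briotBouquet, h4, inv_smul_smul₀ h3, one_smul, add_sub_cancel_right]

theorem DiagField.exists_invCurve (hG : DiagField G a b c)
    (hb : ∀ k : ℕ, 1 ≤ k → b / a - 1 ≠ k) (hc : ∀ k : ℕ, 1 ≤ k → c / a - 1 ≠ k) :
    ∃ R, InvCurve G R := by
  obtain ⟨U, hU⟩ := hG.bbForm.exists_sol fun k hk v => diagCLM_sub_surjective (hb k hk) (hc k hk) v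
  exact ⟨_, InvCurve.of_isBBSol hG hU⟩

theorem DiagField.invCurve_unique (hG : DiagField G a b c)
    (hb : ∀ k : ℕ, 1 ≤ k → b / a - 1 ≠ k) (hc : ∀ k : ℕ, 1 ≤ k → c / a - 1 ≠ k)
    {R' : ℂ → ℂ × ℂ} (hR : InvCurve G R) (hR' : InvCurve G R') : R =ᶠ[𝓝 0] R' := by
  filter_upwards [(hR.isBBSol hG).eventuallyEq hG.bbForm
    (fun k hk u hu => eq_zero_of_diagCLM_eq (hb k hk) (hc k hk) hu) (hR'.isBBSol hG)] with x hx
  rw [hR.eq_smul_dslope, hR'.eq_smul_dslope, hx]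

/-- The steps start from first entries `n - 1, ..., 2`, never from `1`, and end exactly at the
resonance; `hc` keeps the second entry away from `1`. -/
theorem DiagField.resonant_form (hG : DiagField G a b c) {n : ℕ} (hn : 2 ≤ n) (hb : b / a = n)
    (hc : ∀ k : ℕ, c / a - 1 ≠ k + 1) :
    BBForm (bbFun (bbStep^[n - 2] (briotBouquet G))) (diagCLM 1 (c / a - 1 - (n - 2 : ℕ))) ∧
      ((∃ U, IsBBSol (bbFun (briotBouquet G)) U) →
        ∃ V, IsBBSol (bbFun (bbStep^[n - 2] (briotBouquet G))) V) ∧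
      (HasManySols (bbFun (bbStep^[n - 2] (briotBouquet G))) →
        HasManySols (bbFun (briotBouquet G))) := by
  have h := hG.bbForm.iterate_step (n - 2) (fun j hj h => ?_) fun j _ => hc j
  · refine ⟨?_, h.2⟩
    convert h.1 using 2
    rw [hb, Nat.cast_sub hn]
    push_cast
    ring
  · rw [hb] at h
    have : (n : ℂ) = ((j + 2 : ℕ) : ℂ) := by push_cast; linear_combination h
    have := Nat.cast_injective this
    omega

theorem DiagField.coeffP_eq_zero (hG : DiagField G a b c) {n : ℕ} (hn : 2 ≤ n) (hb : b / a = n)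
    (hc : ∀ k : ℕ, c / a - 1 ≠ k + 1) (hR : InvCurve G R) :
    coeffP (bbStep^[n - 2] (briotBouquet G)) = 0 := by
  obtain ⟨h1, h2, -⟩ := hG.resonant_form hn hb hc
  obtain ⟨V, hV⟩ := h2 ⟨_, hR.isBBSol hG⟩
  exact hV.coeffP_eq_zero h1

theorem DiagField.exists_many (hG : DiagField G a b c) {n : ℕ} (hn : 2 ≤ n) (hb : b / a = n)
    (hc : ∀ k : ℕ, c / a - 1 ≠ k + 1) (hp : coeffP (bbStep^[n - 2] (briotBouquet G)) = 0) :
    ∃ ℛ : ℕ → ℂ → ℂ × ℂ, (∀ k, InvCurve G (ℛ k)) ∧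
      Pairwise fun k l => ¬ (ℛ k =ᶠ[𝓝 0] ℛ l) := by
  obtain ⟨h1, -, h3⟩ := hG.resonant_form hn hb hc
  obtain ⟨𝒰, h4, h5⟩ := h3 (h1.hasManySols hp fun k h => hc (k + (n - 2)) (by
    push_cast; linear_combination h))
  refine ⟨_, fun k => InvCurve.of_isBBSol hG (h4 k), fun k l hkl hE => h5 hkl ?_⟩
  filter_upwards [hE] with x hx
  rcases eq_or_ne x 0 with rfl | hx0
  · rw [(h4 k).zero, (h4 l).zero]
  · exact smul_right_injective _ hx0 hx

end DiagonalFields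

/-! ### Center manifolds in adapted linear coordinates. -/

section CenterManifolds

variable {F : Phase → Phase} {L : Phase ≃L[ℂ] Phase} {a b c : ℂ} {v : Phase} {M : Set Phase}

theorem mem_centerSubspace {A : Phase →L[ℂ] Phase} {κ : ℂ} (hκ : κ.re = 0) (hv : A v = κ • v) :
    v ∈ centerSubspace A := by
  refine Submodule.mem_iSup_of_mem κ (Submodule.mem_iSup_of_mem hκ ?_)
  exact Module.End.eigenspace_le_maxGenEigenspace (Module.End.mem_eigenspace_iff.2 hv)

/-- Generalized eigenspaces of different eigenvalues are independent. This excludes the direction of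
`w` as a tangent. -/
theorem eq_zero_of_mem_centerSubspace {A : Phase →L[ℂ] Phase} {κ : ℂ} (hκ : κ.re ≠ 0)
    (hv : A v = κ • v) (hc : v ∈ centerSubspace A) : v = 0 := by
  have h1 := Module.End.independent_maxGenEigenspace (A : Module.End ℂ Phase) κ
  refine Submodule.disjoint_def.1 h1 v
    (Module.End.eigenspace_le_maxGenEigenspace (Module.End.mem_eigenspace_iff.2 hv)) ?_
  have h2 : centerSubspace A ≤ ⨆ (j : ℂ) (_ : j ≠ κ),
      Module.End.maxGenEigenspace (A : Module.End ℂ Phase) j := by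
    refine iSup_mono fun j => iSup_mono' fun hj => ⟨?_, le_rfl⟩
    rintro rfl
    exact hκ hj
  exact h2 hc

theorem IsCenterManifold.of_smul {r : ℂ} (hv : v ≠ 0) (h : IsCenterManifold F (r • v) M) :
    IsCenterManifold F v M := by
  have hr : r ≠ 0 := by
    rintro rfl
    exact h.ne_zero (zero_smul _ _)
  refine ⟨hv, ?_, ?_, h.invariant⟩
  · have := (centerSubspace (fderiv ℂ F 0)).smul_mem r⁻¹ h.mem_center
    rwa [inv_smul_smul₀ hr] at this
  · have h1 := h.curve
    unfold IsHolomorphicCurve at h1 ⊢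
    rwa [Submodule.span_singleton_smul_eq (IsUnit.mk0 r hr)] at h1

theorem InvCurve.exists_centerManifold (hG : HolAt (linConj F L) 0) (hv : v ≠ 0)
    (hc : v ∈ centerSubspace (fderiv ℂ F 0)) (hL : L xAxis = v) {R : ℂ → ℂ × ℂ}
    (hR : InvCurve (linConj F L) R) :
    ∃ M, IsCenterManifold F v M ∧ ∀ᶠ q in 𝓝 0, (L q ∈ M ↔ q.2 = R q.1) := by
  obtain ⟨M, h1, h2, h3⟩ := hR.exists_graph hG
  refine ⟨L.symm ⁻¹' M, ⟨hv, hc, ?_, ?_⟩, by simpa using h3⟩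
  · have := h1.preimage L.symm
    rwa [ContinuousLinearEquiv.symm_symm, hL] at this
  · have := h2.preimage L.symm
    rwa [linConj_symm] at this

theorem IsCenterManifold.exists_invCurve (hG : HolAt (linConj F L) 0) (hL : L xAxis = v)
    (hM : IsCenterManifold F v M) :
    ∃ R, InvCurve (linConj F L) R ∧ ∀ᶠ q in 𝓝 0, (L q ∈ M ↔ q.2 = R q.1) := by
  refine _root_.exists_invCurve (M := L ⁻¹' M) hG ?_ (hM.invariant.preimage L)
  have := hM.curve.preimage L
  rwa [← hL, ContinuousLinearEquiv.symm_apply_apply] at this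

theorem IsCenterManifold.isochronous {ω : ℝ} (hω : ω ≠ 0)
    (hG : DiagField (linConj F L) (Complex.I * ω) b c) (hL : L xAxis = v)
    (hM : IsCenterManifold F v M) : HasIsochronousCenterFamily F M (2 * Real.pi / |ω|) := by
  obtain ⟨R, hR, h⟩ := hM.exists_invCurve hG.hol hL
  have h1 := hR.isochronous hG.hol hG.zero hω (by simp [hG.fderiv_apply, xAxis]) (M := L ⁻¹' M) h
  have := h1.preimage L.symm
  rwa [linConj_symm, preimage_preimage_symm] at this

theorem eventuallyEq_of_graph {M' : Set Phase} {R R' : ℂ → ℂ × ℂ}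
    (h : ∀ᶠ q in 𝓝 0, (L q ∈ M ↔ q.2 = R q.1)) (h' : ∀ᶠ q in 𝓝 0, (L q ∈ M' ↔ q.2 = R' q.1))
    (hRR : R =ᶠ[𝓝 0] R') : M =ᶠ[𝓝 0] M' := by
  have hπ : Tendsto (fun q : Phase => q.1) (𝓝 0) (𝓝 0) := by
    simpa using (continuous_fst (X := ℂ) (Y := ℂ × ℂ)).tendsto 0
  refine eventuallyEq_of_preimage L (eventuallyEq_set.2 ?_)
  filter_upwards [h, h', hπ.eventually hRR] with q h1 h2 h3
  exact h1.trans (by rw [h3]; exact h2.symm)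

theorem IsCenterManifold.eventuallyEq (hG : DiagField (linConj F L) a b c) (hL : L xAxis = v)
    (hb : ∀ k : ℕ, 1 ≤ k → b / a - 1 ≠ k) (hc : ∀ k : ℕ, 1 ≤ k → c / a - 1 ≠ k) {M' : Set Phase}
    (hM : IsCenterManifold F v M) (hM' : IsCenterManifold F v M') : M =ᶠ[𝓝 0] M' := by
  obtain ⟨R, hR, h⟩ := hM.exists_invCurve hG.hol hL
  obtain ⟨R', hR', h'⟩ := hM'.exists_invCurve hG.hol hL
  exact eventuallyEq_of_graph h h' (hG.invCurve_unique hb hc hR hR')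

theorem DiagField.exists_centerManifold (hG : DiagField (linConj F L) a b c) (hv : v ≠ 0)
    (hvc : v ∈ centerSubspace (fderiv ℂ F 0)) (hL : L xAxis = v)
    (hb : ∀ k : ℕ, 1 ≤ k → b / a - 1 ≠ k) (hc : ∀ k : ℕ, 1 ≤ k → c / a - 1 ≠ k) :
    ∃ M, IsCenterManifold F v M := by
  obtain ⟨R, hR⟩ := hG.exists_invCurve hb hc
  obtain ⟨M, hM, -⟩ := hR.exists_centerManifold hG.hol hv hvc hL
  exact ⟨M, hM⟩

theorem DiagField.exists_many_centerManifolds (hG : DiagField (linConj F L) a b c) (hv : v ≠ 0)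
    (hvc : v ∈ centerSubspace (fderiv ℂ F 0)) (hL : L xAxis = v) {n : ℕ} (hn : 2 ≤ n)
    (hb : b / a = n) (hc : ∀ k : ℕ, c / a - 1 ≠ k + 1)
    (hp : coeffP (bbStep^[n - 2] (briotBouquet (linConj F L))) = 0) :
    ∃ 𝓜 : ℕ → Set Phase, (∀ k, IsCenterManifold F v (𝓜 k)) ∧
      Pairwise fun k l => ¬ (𝓜 k =ᶠ[𝓝 0] 𝓜 l) := by
  obtain ⟨ℛ, h1, h2⟩ := hG.exists_many hn hb hc hp
  choose 𝓜 h3 h4 using fun k => (h1 k).exists_centerManifold hG.hol hv hvc hL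
  refine ⟨𝓜, h3, fun k l hkl hE => h2 hkl ?_⟩
  have hE' := (tendsto_linearEquiv_zero L).eventually hE.mem_iff
  filter_upwards [(h1 k).tendsto.eventually (h4 k), (h1 k).tendsto.eventually (h4 l),
    (h1 k).tendsto.eventually hE'] with x h5 h6 h7
  exact h6.1 (h7.1 (h5.2 rfl))

end CenterManifolds

/-! ### The eigenbasis and the exchange of the axes. -/

section Coordinates

/-- The linear coordinates of the basis `xAxis, yAxis, w`. -/
noncomputable def basisEquiv (w : Phase) (hw : w.2.2 ≠ 0) : Phase ≃L[ℂ] Phase :=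
  LinearEquiv.toContinuousLinearEquiv
    { toFun := fun p => p.1 • xAxis + p.2.1 • yAxis + p.2.2 • w
      -- The same formula as in `inBasis`, which makes `linConj F (basisEquiv w hw)` definitionally
      -- equal to `inBasis w F`.
      invFun := fun q => (q.1 - q.2.2 / w.2.2 * w.1, q.2.1 - q.2.2 / w.2.2 * w.2.1, q.2.2 / w.2.2)
      map_add' := fun p q => by
        simp only [Prod.fst_add, Prod.snd_add]
        module
      map_smul' := fun r p => by
        simp only [Prod.smul_fst, Prod.smul_snd, smul_eq_mul, RingHom.id_apply]
        module
      left_inv := fun p => by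
        refine Prod.ext ?_ (Prod.ext ?_ ?_) <;> simp [xAxis, yAxis, hw]
      right_inv := fun q => by
        refine Prod.ext ?_ (Prod.ext ?_ ?_) <;> simp [xAxis, yAxis, hw] }

theorem basisEquiv_apply (w : Phase) (hw : w.2.2 ≠ 0) (p : Phase) :
    basisEquiv w hw p = p.1 • xAxis + p.2.1 • yAxis + p.2.2 • w := rfl

/-- The exchange of the first two coordinates. -/
noncomputable def swapEquiv : Phase ≃L[ℂ] Phase :=
  LinearEquiv.toContinuousLinearEquiv
    { toFun := fun p => (p.2.1, p.1, p.2.2)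
      invFun := fun p => (p.2.1, p.1, p.2.2)
      map_add' := fun _ _ => rfl
      map_smul' := fun _ _ => rfl
      left_inv := fun _ => rfl
      right_inv := fun _ => rfl }

theorem swapEquiv_apply (p : Phase) : swapEquiv p = (p.2.1, p.1, p.2.2) := rfl

theorem swapEquiv_symm_apply (p : Phase) : swapEquiv.symm p = (p.2.1, p.1, p.2.2) := rfl

variable {F : Phase → Phase} {w : Phase} {a b c : ℂ}

/-- Otherwise `w` would lie in the span of two eigenvectors whose eigenvalues differ from its own.
Hence the axes and `w` form a basis. -/
theorem snd_snd_ne_zero_of_eigenvector {A : Phase →L[ℂ] Phase} (hx : A xAxis = a • xAxis)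
    (hy : A yAxis = b • yAxis) (hw0 : w ≠ 0) (hw : A w = c • w) (hac : a ≠ c) (hbc : b ≠ c) :
    w.2.2 ≠ 0 := by
  intro h
  have hwe : w = w.1 • xAxis + w.2.1 • yAxis := by
    refine Prod.ext ?_ (Prod.ext ?_ ?_) <;> simp [xAxis, yAxis, h]
  have h1 : A w = (w.1 * a) • xAxis + (w.2.1 * b) • yAxis := by
    conv_lhs => rw [hwe]
    rw [map_add, map_smul, map_smul, hx, hy, smul_smul, smul_smul]
  rw [hw] at h1
  have h2 := congrArg Prod.fst h1
  have h3 := congrArg (fun p : Phase => p.2.1) h1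
  simp only [Prod.smul_fst, smul_eq_mul, xAxis, yAxis, Prod.smul_mk, Prod.mk_add_mk, mul_one,
    mul_zero, add_zero, zero_add, Prod.smul_snd] at h2 h3
  have h4 : w.1 = 0 := by
    have : w.1 * (a - c) = 0 := by linear_combination -h2
    exact (mul_eq_zero.1 this).resolve_right (sub_ne_zero.2 hac)
  have h5 : w.2.1 = 0 := by
    have : w.2.1 * (b - c) = 0 := by linear_combination -h3
    exact (mul_eq_zero.1 this).resolve_right (sub_ne_zero.2 hbc)
  exact hw0 (Prod.ext h4 (Prod.ext h5 h))

theorem diagField_basisEquiv (hF : HolAt F 0) (hF0 : F 0 = 0)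
    (hx : fderiv ℂ F 0 xAxis = a • xAxis) (hy : fderiv ℂ F 0 yAxis = b • yAxis)
    (hw : fderiv ℂ F 0 w = c • w) (hw0 : w.2.2 ≠ 0) (ha : a ≠ 0) :
    DiagField (linConj F (basisEquiv w hw0)) a b c where
  hol := hF.linConj _
  zero := by simp [linConj, hF0]
  fderiv_apply p := by
    rw [fderiv_linConj _ hF, ContinuousLinearEquiv.symm_apply_eq, basisEquiv_apply,
      basisEquiv_apply]
    simp only [map_add, map_smul, hx, hy, hw]
    module
  ne_zero := ha

/-- With the `y`-axis in first place, the results on curves tangent to the first axis also serve the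
`y`-invariant case. -/
theorem DiagField.swap {L : Phase ≃L[ℂ] Phase} (hG : DiagField (linConj F L) a b c) (hb : b ≠ 0) :
    DiagField (linConj F (swapEquiv.trans L)) b a c := by
  have h : linConj F (swapEquiv.trans L) = linConj (linConj F L) swapEquiv := rfl
  rw [h]
  refine ⟨hG.hol.linConj _, ?_, fun p => ?_, hb⟩
  · have h0 := hG.zero
    rw [linConj, map_zero, h0, map_zero]
  · rw [fderiv_linConj _ hG.hol, hG.fderiv_apply, swapEquiv_symm_apply, swapEquiv_apply]

/-- A center manifold is tangent to the `x`-axis or to the `y`-axis. -/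
theorem IsCenterManifold.xAxis_or_yAxis (hF : HolAt F 0) (hF0 : F 0 = 0)
    (hx : fderiv ℂ F 0 xAxis = a • xAxis) (hy : fderiv ℂ F 0 yAxis = b • yAxis)
    (hw : fderiv ℂ F 0 w = c • w) (hw0 : w.2.2 ≠ 0) (hab : a ≠ b)
    (hc : c.re ≠ 0) {v : Phase} {M : Set Phase} (hM : IsCenterManifold F v M) :
    IsCenterManifold F xAxis M ∨ IsCenterManifold F yAxis M := by
  obtain ⟨κ, hκ⟩ := hM.invariant.exists_eigenvalue hF hF0 hM.ne_zero hM.curve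
  obtain ⟨p, rfl⟩ := (basisEquiv w hw0).surjective v
  have h1 : (basisEquiv w hw0) (a * p.1, b * p.2.1, c * p.2.2) =
      (basisEquiv w hw0) (κ • p) := by
    rw [map_smul, ← hκ, basisEquiv_apply, basisEquiv_apply]
    simp only [map_add, map_smul, hx, hy, hw]
    module
  have h2 := (basisEquiv w hw0).injective h1
  have h3 : a * p.1 = κ * p.1 := congrArg Prod.fst h2
  have h4 : b * p.2.1 = κ * p.2.1 := congrArg (fun p : Phase => p.2.1) h2
  have h5 : c * p.2.2 = κ * p.2.2 := congrArg (fun p : Phase => p.2.2) h2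
  have hzero : ∀ {d z : ℂ}, d * z = κ * z → d ≠ κ → z = 0 := fun h hd =>
    (mul_eq_mul_right_iff.1 h).resolve_left hd
  have hxne : xAxis ≠ 0 := fun h => one_ne_zero (congrArg Prod.fst h)
  have hyne : yAxis ≠ 0 := fun h => one_ne_zero (congrArg (fun p : Phase => p.2.1) h)
  -- The eigenvalue `c` is off the imaginary axis, so its eigenvectors are not in the center
  -- subspace; otherwise `a ≠ b` leaves a single nonzero coordinate.
  by_cases hcκ : c = κ
  · exact absurd (eq_zero_of_mem_centerSubspace (by rwa [← hcκ]) hκ hM.mem_center) hM.ne_zero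
  · have h6 := hzero h5 hcκ
    by_cases haκ : a = κ
    · have h7 := hzero h4 (fun h => hab (haκ.trans h.symm))
      have h8 : (basisEquiv w hw0) p = p.1 • xAxis := by
        rw [basisEquiv_apply, h6, h7]; simp
      rw [h8] at hM
      exact Or.inl (hM.of_smul hxne)
    · have h7 := hzero h3 haκ
      have h8 : (basisEquiv w hw0) p = p.2.1 • yAxis := by
        rw [basisEquiv_apply, h6, h7]; simp
      rw [h8] at hM
      exact Or.inr (hM.of_smul hyne)

end Coordinates

/-! ### The main theorem. -/

theorem div_I_mul_sub_one_ne {lam : ℂ} (hlam : lam.re ≠ 0) {ω : ℝ} (hω : ω ≠ 0) (r : ℝ) :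
    lam / (Complex.I * ω) - 1 ≠ r := by
  intro h
  have hω' : Complex.I * (ω : ℂ) ≠ 0 := by simp [hω]
  rw [sub_eq_iff_eq_add, div_eq_iff hω'] at h
  apply hlam
  rw [h]
  simp

theorem theoremT (F : Phase → Phase) (hF : AnalyticAt ℂ F 0) (hF0 : F 0 = 0)
    (ω₁ ω₂ : ℝ) (lam : ℂ) (w : Phase)
    (hω₁ : ω₁ ≠ 0) (hω₂ : ω₂ ≠ 0) (hne : ω₁ ≠ ω₂) (hle : |ω₁| ≤ |ω₂|)
    (hx : fderiv ℂ F 0 xAxis = (Complex.I * ω₁) • xAxis)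
    (hy : fderiv ℂ F 0 yAxis = (Complex.I * ω₂) • yAxis)
    (hlam : lam.re ≠ 0) (hw0 : w ≠ 0) (hw : fderiv ℂ F 0 w = lam • w) :
    -- a `y`-invariant center manifold always exists
    (∃ M, IsCenterManifold F yAxis M ∧
      HasIsochronousCenterFamily F M (2 * Real.pi / |ω₂|)) ∧
    -- the nonresonant case
    ((¬ ∃ n : ℕ, ω₂ / ω₁ = n) →
      ∃ M, IsCenterManifold F xAxis M ∧
        HasIsochronousCenterFamily F M (2 * Real.pi / |ω₁|)) ∧
    -- the resonant case
    (∀ n : ℕ, ω₂ / ω₁ = n →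
      (pBar F w n = 0 →
        (∃ 𝓜 : ℕ → Set Phase, (∀ k, IsCenterManifold F xAxis (𝓜 k)) ∧
          Pairwise fun k l => ¬ (𝓜 k =ᶠ[𝓝 0] 𝓜 l)) ∧
        ∀ M, IsCenterManifold F xAxis M →
          HasIsochronousCenterFamily F M (2 * Real.pi / |ω₁|)) ∧
      (pBar F w n ≠ 0 →
        (¬ ∃ M, IsCenterManifold F xAxis M) ∧
        ∃ M₀, IsCenterManifold F yAxis M₀ ∧
          HasIsochronousCenterFamily F M₀ (2 * Real.pi / |ω₂|) ∧
          ∀ v M, IsCenterManifold F v M → M =ᶠ[𝓝 0] M₀)) := by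
  have hFh := hF.holAt
  have hre : ∀ ω : ℝ, (Complex.I * (ω : ℂ)).re = 0 := fun ω => by simp
  have hIne : ∀ ω : ℝ, ω ≠ 0 → Complex.I * (ω : ℂ) ≠ 0 := fun ω h => by simp [h]
  have hIlam : ∀ ω : ℝ, Complex.I * (ω : ℂ) ≠ lam := fun ω h => hlam (by rw [← h, hre])
  have hdiv : ∀ ω ω' : ℝ, Complex.I * (ω' : ℂ) / (Complex.I * ω) = ((ω' / ω : ℝ) : ℂ) :=
    fun ω ω' => by
      rw [mul_div_mul_left _ _ Complex.I_ne_zero]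
      push_cast
      rfl
  have hw2 := snd_snd_ne_zero_of_eigenvector hx hy hw0 hw (hIlam ω₁) (hIlam ω₂)
  have hGx := diagField_basisEquiv hFh hF0 hx hy hw hw2 (hIne ω₁ hω₁)
  have hGy := hGx.swap (hIne ω₂ hω₂)
  have hLx : basisEquiv w hw2 xAxis = xAxis := by
    rw [basisEquiv_apply]
    simp [xAxis]
  have hLy : (swapEquiv.trans (basisEquiv w hw2)) xAxis = yAxis := by
    have : (swapEquiv.trans (basisEquiv w hw2)) xAxis = basisEquiv w hw2 yAxis := rfl
    rw [this, basisEquiv_apply]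
    simp [yAxis]
  have hxne : xAxis ≠ 0 := fun h => one_ne_zero (congrArg Prod.fst h)
  have hyne : yAxis ≠ 0 := fun h => one_ne_zero (congrArg (fun p : Phase => p.2.1) h)
  have hxc := mem_centerSubspace (hre ω₁) hx
  have hyc := mem_centerSubspace (hre ω₂) hy
  have hlamk : ∀ ω : ℝ, ω ≠ 0 → ∀ k : ℕ, 1 ≤ k → lam / (Complex.I * ω) - 1 ≠ k :=
    fun ω hω k _ h => div_I_mul_sub_one_ne hlam hω k (by rw [h]; simp)
  -- Equality would give `|ω₁| / |ω₂| = k + 1 ≥ 2`, against `|ω₁| ≤ |ω₂|`.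
  have hyk : ∀ k : ℕ, 1 ≤ k → Complex.I * (ω₁ : ℂ) / (Complex.I * ω₂) - 1 ≠ k := by
    intro k hk h
    rw [hdiv] at h
    have h1 : ω₁ / ω₂ - 1 = k := by exact_mod_cast h
    have h2 : ω₁ / ω₂ = k + 1 := by linarith
    have h3 : |ω₁| / |ω₂| = k + 1 := by
      rw [← abs_div, h2, abs_of_nonneg (by positivity)]
    have h4 := (div_le_one (abs_pos.2 hω₂)).2 hle
    have h5 : (1 : ℝ) ≤ k := by exact_mod_cast hk
    linarith
  have hlam₂ := hlamk ω₂ hω₂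
  obtain ⟨M₀, hM₀⟩ := hGy.exists_centerManifold hyne hyc hLy hyk hlam₂
  refine ⟨⟨M₀, hM₀, hM₀.isochronous hω₂ hGy hLy⟩, fun hnr => ?_, fun n hn => ?_⟩
  · obtain ⟨M, hM⟩ := hGx.exists_centerManifold hxne hxc hLx (fun k _ h => by
      rw [hdiv] at h
      have h1 : ω₂ / ω₁ - 1 = k := by exact_mod_cast h
      exact hnr ⟨k + 1, by push_cast; linarith⟩) (hlamk ω₁ hω₁)
    exact ⟨M, hM, hM.isochronous hω₁ hGx hLx⟩
  -- The values `0` and `1` are excluded by `ω₂ ≠ 0` and `ω₁ ≠ ω₂`, so `n - 2` is a true difference.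
  · have hn2 : 2 ≤ n := by
      have h0 : n ≠ 0 := by
        rintro rfl
        simp [hω₁, hω₂] at hn
      have h1 : n ≠ 1 := by
        rintro rfl
        rw [div_eq_iff hω₁] at hn
        apply hne
        rw [hn]
        simp
      omega
    have hb : Complex.I * (ω₂ : ℂ) / (Complex.I * ω₁) = n := by
      rw [hdiv, hn]
      simp
    have hc : ∀ k : ℕ, lam / (Complex.I * ω₁) - 1 ≠ k + 1 := fun k h =>
      hlamk ω₁ hω₁ (k + 1) (by omega) (by rw [h]; push_cast; rfl)
    have hp : pBar F w n =
        coeffP (bbStep^[n - 2] (briotBouquet (linConj F (basisEquiv w hw2)))) := rfl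
    rw [hp]
    refine ⟨fun h0 => ⟨hGx.exists_many_centerManifolds hxne hxc hLx hn2 hb hc h0,
      fun M hM => hM.isochronous hω₁ hGx hLx⟩, fun h0 => ?_⟩
    have hno : ¬ ∃ M, IsCenterManifold F xAxis M := by
      rintro ⟨M, hM⟩
      obtain ⟨R, hR, -⟩ := hM.exists_invCurve hGx.hol hLx
      exact h0 (hGx.coeffP_eq_zero hn2 hb hc hR)
    refine ⟨hno, M₀, hM₀, hM₀.isochronous hω₂ hGy hLy, fun v M hM => ?_⟩
    rcases hM.xAxis_or_yAxis hFh hF0 hx hy hw hw2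
      (fun h => hne (by exact_mod_cast mul_left_cancel₀ Complex.I_ne_zero h)) hlam with h | h
    · exact absurd ⟨M, h⟩ hno
    · exact h.eventuallyEq hGy hLy hyk hlam₂ hM₀
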